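/- Let $(N^4,h)$ be a smooth $4$-dimensional Riemannian manifold of constant sectional curvature $c\neq 0$ (a space form; neither completeness nor simple connectedness is required), let $(M^2,g)$ be a smooth Riemannian surface without boundary, and let $\varphi:(M^2,g)\to(N^4,h)$ be a smooth isometric immersion. Denote by $B$ its second fundamental form, by $H=\tfrac12\operatorname{trace}_g B$ its mean curvature vector field, by $A_H$ the shape operator in the direction of $H$, $\langle A_H X,Y\rangle=\langle B(X,Y),H\rangle$, and by $\nabla^\perp$ the normal connection. Let $S_2=-2|H|^2g+4A_H$ be the stress-bienergy tensor, where $A_H$ is viewed as the symmetric $(0,2)$-tensor $(X,Y)\mapsto\langle A_HX,Y\rangle$. Suppose that the surface is biconservative, i.e. $\operatorname{Div}S_2=0$ on $M$, and CMC, i.e. $|H|$ is constant on $M$. Then it is PMC: its mean curvature vector field is parallel in the normal bundle, $\nabla^\perp H=0$ on $M$. -/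

import Mathlib

open scoped Manifold ContDiff

noncomputable section

namespace SpaceFormSurface

/-! ## Riemannian geometry of an open subset of `ℝⁿ`

The standard coordinate expressions, evaluated at a point `x` of the coordinate domain.  Tangent
vectors are elements of `ℝⁿ`; they are also regarded as constant (coordinate) vector fields. -/

/-- Coordinate space `ℝⁿ`. -/
abbrev Coord (n : ℕ) : Type := EuclideanSpace ℝ (Fin n)

/-- A field of bilinear forms on `ℝⁿ`: the coefficients of a metric in a chart. -/
abbrev BilinField (n : ℕ) : Type := Coord n → Coord n →L[ℝ] Coord n →L[ℝ] ℝ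

/-- The coordinate vector `∂ᵢ`. -/
def bvec {n : ℕ} (i : Fin n) : Coord n := EuclideanSpace.single i 1

/-- The matrix `(g_{ij})` of a metric at `x`. -/
def gram {n : ℕ} (g : BilinField n) (x : Coord n) : Matrix (Fin n) (Fin n) ℝ :=
  Matrix.of fun i j => g x (bvec i) (bvec j)

/-- `2 ⟨∇_u v, w⟩ = ∂_u g(v, w) + ∂_v g(u, w) - ∂_w g(u, v)` for constant fields `u, v, w`. -/
def koszul {n : ℕ} (g : BilinField n) (x u v w : Coord n) : ℝ :=
  fderiv ℝ g x u v w + fderiv ℝ g x v u w - fderiv ℝ g x w u v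

/-- The Levi-Civita connection on constant fields,
`Γ(u, v)ᵏ = ½ ∑ₗ g^{kl} (∂_u g(v, ∂ₗ) + ∂_v g(u, ∂ₗ) - ∂ₗ g(u, v))`;
`Γ(∂ᵢ, ∂ⱼ)ᵏ` is the Christoffel symbol `Γᵏᵢⱼ`. -/
def christoffel {n : ℕ} (g : BilinField n) (x u v : Coord n) : Coord n :=
  WithLp.toLp 2 fun k => (1 / 2 : ℝ) * ∑ l, (gram g x)⁻¹ k l * koszul g x u v (bvec l)

/-- The curvature tensor `R(u, v)w = ∇_u ∇_v w - ∇_v ∇_u w` for constant fields `u, v, w`. -/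
def curvature {n : ℕ} (g : BilinField n) (x u v w : Coord n) : Coord n :=
  fderiv ℝ (fun y => christoffel g y v w) x u + christoffel g x u (christoffel g x v w)
    - (fderiv ℝ (fun y => christoffel g y u w) x v + christoffel g x v (christoffel g x u w))

/-- The sectional curvature of the plane spanned by `u` and `v`. -/
def sectional {n : ℕ} (g : BilinField n) (x u v : Coord n) : ℝ :=
  g x (curvature g x u v v) u / (g x u u * g x v v - g x u v ^ 2)

/-- The divergence `(Div T)(v) = ∑ᵢⱼ g^{ij} (∇_{∂ᵢ} T)(∂ⱼ, v)` of a `(0,2)`-tensor field `T`. -/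
def divergence {n : ℕ} (g : BilinField n) (T : Coord n → Coord n → Coord n → ℝ)
    (x v : Coord n) : ℝ :=
  ∑ i, ∑ j, (gram g x)⁻¹ i j *
    (fderiv ℝ (fun y => T y (bvec j) v) x (bvec i)
      - T x (christoffel g x (bvec i) (bvec j)) v
      - T x (bvec j) (christoffel g x (bvec i) v))

/-! ## Isometric immersions in coordinates -/

/-- The expression in charts of a map `F` from an `m`-dimensional Riemannian manifold with metric
`g` to an `n`-dimensional one with metric `h`. -/
structure LocalMap (m n : ℕ) where
  /-- the metric of the source -/
  g : BilinField m
  /-- the metric of the target -/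
  h : BilinField n
  /-- the map -/
  F : Coord m → Coord n

namespace LocalMap

variable {m n : ℕ} (L : LocalMap m n)

/-- `∇_u V`, for a vector field `V` along `F`: the connection induced by the Levi-Civita
connection of the target. -/
def cov (V : Coord m → Coord n) (x u : Coord m) : Coord n :=
  fderiv ℝ V x u + christoffel L.h (L.F x) (fderiv ℝ L.F x u) (V x)

/-- The normal component `V - ∑ᵢⱼ g^{ij} ⟨V, dF(∂ᵢ)⟩ dF(∂ⱼ)` of a vector `V` at `F x`. -/
def normalPart (x : Coord m) (V : Coord n) : Coord n :=
  V - ∑ i, ∑ j, ((gram L.g x)⁻¹ i j * L.h (L.F x) V (fderiv ℝ L.F x (bvec i))) •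
    fderiv ℝ L.F x (bvec j)

/-- The second fundamental form `B(u, v) = (∇_u dF(v))^⊥`. -/
def secondFF (x u v : Coord m) : Coord n :=
  L.normalPart x (L.cov (fun y => fderiv ℝ L.F y v) x u)

/-- The mean curvature vector `H = (1/m) trace B`. -/
def meanCurv (x : Coord m) : Coord n :=
  (1 / (m : ℝ)) • ∑ i, ∑ j, (gram L.g x)⁻¹ i j • L.secondFF x (bvec i) (bvec j)

/-- `|H|`. -/
def normMeanCurv (x : Coord m) : ℝ :=
  √(L.h (L.F x) (L.meanCurv x) (L.meanCurv x))

/-- The normal covariant derivative `∇^⊥_u H = (∇_u H)^⊥` of the mean curvature vector. -/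
def normalCovMeanCurv (x u : Coord m) : Coord n :=
  L.normalPart x (L.cov L.meanCurv x u)

/-- The shape operator in the direction of `η`, as a `(0,2)`-tensor:
`⟨A_η u, v⟩ = ⟨B(u, v), η⟩`. -/
def shape (x : Coord m) (η : Coord n) (u v : Coord m) : ℝ :=
  L.h (L.F x) (L.secondFF x u v) η

/-- The stress-bienergy tensor `S₂ = -2 |H|² g + 4 A_H` of an isometrically immersed surface. -/
def stressBienergy (L : LocalMap 2 n) (x u v : Coord 2) : ℝ :=
  -2 * L.normMeanCurv x ^ 2 * L.g x u v + 4 * L.shape x (L.meanCurv x) u v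

end LocalMap

/-! ## Manifolds

All the objects above are expressions in charts of objects that do not depend on the charts, so a
property of them may be required at every point, in every chart of the smooth structure. -/

/-- Smooth Riemannian metrics on an `n`-dimensional manifold without boundary. -/
abbrev Metric (n : ℕ) (N : Type*) [TopologicalSpace N] [ChartedSpace (Coord n) N]
    [IsManifold (𝓡 n) ∞ N] :=
  Bundle.ContMDiffRiemannianMetric (𝓡 n) ∞ (Coord n) (fun x : N => TangentSpace (𝓡 n) x)

section Manifold

variable {m n : ℕ}
  {M : Type*} [TopologicalSpace M] [ChartedSpace (Coord m) M] [IsManifold (𝓡 m) ∞ M]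
  {N : Type*} [TopologicalSpace N] [ChartedSpace (Coord n) N] [IsManifold (𝓡 n) ∞ N]

/-- The coefficients of a Riemannian metric in the chart `e`. -/
def metricInChart (h : Metric n N) (e : OpenPartialHomeomorph N (Coord n)) : BilinField n :=
  fun y =>
    let b : Coord n →L[ℝ] Coord n →L[ℝ] ℝ := h.inner (e.symm y)
    let D : Coord n →L[ℝ] Coord n := mfderiv (𝓡 n) (𝓡 n) e.symm y
    b.bilinearComp D D

/-- The expression of `φ : (M, g) → (N, h)` in the charts `e` of `M` and `e'` of `N`. -/
def inCharts (g : Metric m M) (h : Metric n N) (φ : M → N)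
    (e : OpenPartialHomeomorph M (Coord m)) (e' : OpenPartialHomeomorph N (Coord n)) :
    LocalMap m n where
  g := metricInChart g e
  h := metricInChart h e'
  F := fun y => e' (φ (e.symm y))

/-- `(N, h)` has constant sectional curvature `c`. -/
def HasConstantSectionalCurvature (h : Metric n N) (c : ℝ) : Prop :=
  ∀ e ∈ IsManifold.maximalAtlas (𝓡 n) ∞ N, ∀ p ∈ e.source, ∀ u v : Coord n,
    LinearIndependent ℝ ![u, v] → sectional (metricInChart h e) (e p) u v = c

/-- `φ : (M, g) → (N, h)` is a smooth isometric immersion: `φ^* h = g`. -/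
def IsIsometricImmersion (g : Metric m M) (h : Metric n N) (φ : M → N) : Prop :=
  ContMDiff (𝓡 m) (𝓡 n) ∞ φ ∧
    ∀ (p : M) (u v : TangentSpace (𝓡 m) p),
      h.inner (φ p) (mfderiv (𝓡 m) (𝓡 n) φ p u) (mfderiv (𝓡 m) (𝓡 n) φ p v) = g.inner p u v

/-- CMC: `|H|` is constant. -/
def IsCMC (g : Metric m M) (h : Metric n N) (φ : M → N) : Prop :=
  ∃ κ : ℝ, ∀ e ∈ IsManifold.maximalAtlas (𝓡 m) ∞ M, ∀ e' ∈ IsManifold.maximalAtlas (𝓡 n) ∞ N,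
    ∀ p ∈ e.source, φ p ∈ e'.source → (inCharts g h φ e e').normMeanCurv (e p) = κ

/-- PMC: `∇^⊥ H = 0`. -/
def IsPMC (g : Metric m M) (h : Metric n N) (φ : M → N) : Prop :=
  ∀ e ∈ IsManifold.maximalAtlas (𝓡 m) ∞ M, ∀ e' ∈ IsManifold.maximalAtlas (𝓡 n) ∞ N,
    ∀ p ∈ e.source, φ p ∈ e'.source →
      ∀ u : Coord m, (inCharts g h φ e e').normalCovMeanCurv (e p) u = 0

end Manifold

/-- An isometrically immersed surface is biconservative if `Div S₂ = 0`. -/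
def IsBiconservative {n : ℕ}
    {M : Type*} [TopologicalSpace M] [ChartedSpace (Coord 2) M] [IsManifold (𝓡 2) ∞ M]
    {N : Type*} [TopologicalSpace N] [ChartedSpace (Coord n) N] [IsManifold (𝓡 n) ∞ N]
    (g : Metric 2 M) (h : Metric n N) (φ : M → N) : Prop :=
  ∀ e ∈ IsManifold.maximalAtlas (𝓡 2) ∞ M, ∀ e' ∈ IsManifold.maximalAtlas (𝓡 n) ∞ N,
    ∀ p ∈ e.source, φ p ∈ e'.source → ∀ v : Coord 2,
      divergence (inCharts g h φ e e').g (inCharts g h φ e e').stressBienergy (e p) v = 0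

end SpaceFormSurface

end

noncomputable section

namespace SpaceFormSurface

/-! ## Metrics in a chart -/

/-! The assertion is local, and the local form `LocalMap.IsIsometricOn.normalCovMeanCurv_eq_zero` is
proved by contradiction. Suppose `N = ∇^⊥_{u₀} H` is nonzero at a point, hence nearby. Then `κ =
|H|` is nonzero, and constancy of `|H|` gives `N ⟂ H`. In codimension two, `H` and `N` therefore
span the normal planes, so `∇^⊥ H` is determined by the one-form `τ(u) = ⟨∇_u H, N⟩`.

For constant `|H|` the Codazzi equation turns `Div S₂ = 0` into `trace ⟨B(v, ·), ∇^⊥_· H⟩ = 0`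
(`divergence_stressBienergy`). In an orthonormal tangent frame with `τ(e₁) = 0` and `τ(e₀) ≠ 0` this
says `A_N e₀ = 0`. Since also `trace A_N = 2⟨H, N⟩ = 0`, the whole of `A_N` vanishes.

The structure equations of the frame `e₀, e₁, E₂ = H/κ, E₃ = N/|N|` finish the argument
(`eq_zero_of_frame`). As `A_{E₃} = 0`, Codazzi for `E₃` reads `ω₂₃ ∧ ω₂₀ = ω₂₃ ∧ ω₂₁ = 0`, so `A_H
e₁ = 0`. Hence `ω₂₁ = 0` and `ω₂₀ = -2κ θ₀`. Codazzi for `E₂` then forces `ω₀₁ = 0`, so the surface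
is flat. But `A_{E₂}` has rank one and `A_{E₃} = 0`, so by the Gauss equation the surface has
curvature `c`. Thus `c = 0`, against the hypothesis. -/

/-- `h` restricts to a smooth Riemannian metric on the open set `W`. -/
structure IsMetricOn {n : ℕ} (h : BilinField n) (W : Set (Coord n)) : Prop where
  isOpen : IsOpen W
  smooth : ContDiffOn ℝ ∞ h W
  symm : ∀ z ∈ W, ∀ u v, h z u v = h z v u
  pos : ∀ z ∈ W, ∀ u, u ≠ 0 → 0 < h z u u

lemma sum_bvec {n : ℕ} (u : Coord n) : ∑ i, u i • bvec i = u := by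
  simpa [bvec, EuclideanSpace.basisFun_apply] using (EuclideanSpace.basisFun (Fin n) ℝ).sum_repr u

lemma coord_eq_sum_bvec {n : ℕ} (f : Fin n → ℝ) :
    (WithLp.toLp 2 f : Coord n) = ∑ i, f i • bvec i :=
  (sum_bvec (WithLp.toLp 2 f)).symm

lemma gram_mulVec {n : ℕ} (h : BilinField n) (z : Coord n) (f : Fin n → ℝ) (j : Fin n) :
    (gram h z).mulVec f j = h z (bvec j) (WithLp.toLp 2 f) := by
  simp [gram, Matrix.mulVec, dotProduct, coord_eq_sum_bvec, mul_comm]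

namespace IsMetricOn

variable {n : ℕ} {h : BilinField n} {W : Set (Coord n)} (hm : IsMetricOn h W)
  {z : Coord n} (hz : z ∈ W)

include hm hz

lemma contDiffAt : ContDiffAt ℝ ∞ h z := hm.smooth.contDiffAt (hm.isOpen.mem_nhds hz)

lemma differentiableAt : DifferentiableAt ℝ h z :=
  (hm.contDiffAt hz).differentiableAt (by norm_num)

lemma nonneg (u : Coord n) : 0 ≤ h z u u := by
  by_cases hu : u = 0
  · simp [hu]
  · exact (hm.pos z hz u hu).le

lemma eq_zero_of_self {u : Coord n} (hu : h z u u = 0) : u = 0 := by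
  by_contra hne
  exact (hm.pos z hz u hne).ne' hu

lemma ext_inner {u v : Coord n} (huv : ∀ w, h z u w = h z v w) : u = v := by
  have := hm.eq_zero_of_self hz (u := u - v) (by simp [huv])
  exact sub_eq_zero.1 this

/-- A kernel vector of the Gram matrix would have zero length. -/
lemma isUnit_det : IsUnit (gram h z).det := by
  rw [isUnit_iff_ne_zero]
  intro h0
  obtain ⟨f, hf, hf0⟩ := Matrix.exists_mulVec_eq_zero_iff.2 h0
  apply hf
  have h1 : h z (WithLp.toLp 2 f) (WithLp.toLp 2 f) = 0 := by
    conv_lhs => enter [1]; rw [coord_eq_sum_bvec]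
    simp [← gram_mulVec h z, hf0]
  have := hm.eq_zero_of_self hz h1
  ext i
  simpa using congrArg (fun u : Coord n => u i) this

lemma inner_gram_inv (a : Fin n → ℝ) (j : Fin n) :
    h z (WithLp.toLp 2 fun k => ∑ l, (gram h z)⁻¹ k l * a l) (bvec j) = a j := by
  rw [hm.symm z hz, ← gram_mulVec h z]
  have : (fun k => ∑ l, (gram h z)⁻¹ k l * a l) = (gram h z)⁻¹.mulVec a := rfl
  rw [this, Matrix.mulVec_mulVec, Matrix.mul_nonsing_inv _ (hm.isUnit_det hz), Matrix.one_mulVec]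

lemma gram_inv_symm (i j : Fin n) : (gram h z)⁻¹ i j = (gram h z)⁻¹ j i := by
  have h1 : (gram h z).transpose = gram h z := by
    ext i j; simp [gram, hm.symm z hz (bvec i)]
  conv_lhs => rw [← h1, ← Matrix.transpose_nonsing_inv, Matrix.transpose_apply]

lemma sum_gram_inv_inner (u : Coord n) :
    ∑ i, ∑ j, ((gram h z)⁻¹ i j * h z u (bvec i)) • bvec j = u := by
  apply hm.ext_inner hz
  intro w
  rw [← sum_bvec w]
  simp only [map_sum, map_smul]
  refine Finset.sum_congr rfl fun k _ => ?_
  congr 1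
  rw [← inner_gram_inv hm hz (fun i => h z u (bvec i)) k, coord_eq_sum_bvec, Finset.sum_comm]
  simp [Finset.sum_smul, gram_inv_symm hm hz]

lemma inner_christoffel (u v w : Coord n) :
    2 * h z (christoffel h z u v) w = koszul h z u v w := by
  have key : ∀ j, h z (christoffel h z u v) (bvec j) = 1 / 2 * koszul h z u v (bvec j) := by
    intro j
    rw [← inner_gram_inv hm hz (fun j => 1 / 2 * koszul h z u v (bvec j)) j]
    congr 2
    simp only [christoffel]
    congr 1
    ext k
    simp only [Finset.mul_sum]
    exact Finset.sum_congr rfl fun l _ => by ring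
  rw [← sum_bvec w]
  simp only [koszul, map_sum, map_smul, key, smul_eq_mul, sum_apply,
    smul_apply]
  rw [Finset.mul_sum, ← Finset.sum_add_distrib, ← Finset.sum_sub_distrib]
  exact Finset.sum_congr rfl fun l _ => by ring

lemma fderiv_symm (u v w : Coord n) : fderiv ℝ h z u v w = fderiv ℝ h z u w v := by
  have hd := hm.differentiableAt hz
  have e1 : ∀ v w, fderiv ℝ (fun y => h y v w) z u = fderiv ℝ h z u v w := by
    intro v w
    have h1 : HasFDerivAt (fun y => h y v w) _ z :=
      (hd.hasFDerivAt.clm_apply (hasFDerivAt_const v z)).clm_apply (hasFDerivAt_const w z)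
    rw [h1.fderiv]
    simp
  rw [← e1, ← e1]
  congr 1
  apply Filter.EventuallyEq.fderiv_eq
  filter_upwards [hm.isOpen.mem_nhds hz] with y hy using hm.symm y hy v w

lemma christoffel_symm (u v : Coord n) : christoffel h z u v = christoffel h z v u := by
  apply hm.ext_inner hz
  intro w
  have h1 := hm.inner_christoffel hz u v w
  have h2 := hm.inner_christoffel hz v u w
  have h3 := hm.fderiv_symm hz w u v
  simp only [koszul] at h1 h2
  linarith

/-- Metric compatibility: adding the Koszul formulas for `⟨Γ(u, v), w⟩` and `⟨Γ(u, w), v⟩` cancels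
everything except `∂_u h(v, w)`. -/
lemma fderiv_metric (u v w : Coord n) :
    fderiv ℝ h z u v w = h z (christoffel h z u v) w + h z v (christoffel h z u w) := by
  have h1 := hm.inner_christoffel hz u v w
  have h2 := hm.inner_christoffel hz u w v
  rw [hm.symm z hz] at h2
  have h3 := hm.fderiv_symm hz u v w
  have h4 := hm.fderiv_symm hz v u w
  have h5 := hm.fderiv_symm hz w u v
  simp only [koszul] at h1 h2
  linarith

-- Cramer's rule: each entry of the inverse is a quotient of determinants, the numerator having row
-- `j` of the Gram matrix replaced by a constant basis vector.
omit hz in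
lemma contDiffOn_gram_inv (i j : Fin n) : ContDiffOn ℝ ∞ (fun z => (gram h z)⁻¹ i j) W := by
  have hg : ∀ i j, ContDiffOn ℝ ∞ (fun z => gram h z i j) W := fun i j =>
    (hm.smooth.clm_apply contDiffOn_const).clm_apply contDiffOn_const
  have hdet : ∀ A : Coord n → Matrix (Fin n) (Fin n) ℝ,
      (∀ i j, ContDiffOn ℝ ∞ (fun z => A z i j) W) → ContDiffOn ℝ ∞ (fun z => (A z).det) W := by
    intro A hA
    simp only [Matrix.det_apply]
    exact ContDiffOn.sum fun σ _ => (contDiffOn_prod fun i _ => hA _ _).const_smul _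
  simp only [Matrix.inv_def, Ring.inverse_eq_inv', Matrix.smul_apply, smul_eq_mul,
    Matrix.adjugate_apply]
  refine ((hdet _ hg).inv fun z hz => (hm.isUnit_det hz).ne_zero).mul (hdet _ fun k l => ?_)
  by_cases hk : k = j
  · subst hk; simpa using contDiffOn_const
  · simpa [Matrix.updateRow_ne hk] using hg k l

end IsMetricOn


/-- The Levi-Civita connection of a metric as a field of continuous bilinear maps. -/
def christoffelCLM {n : ℕ} (h : BilinField n) (z : Coord n) :
    Coord n →L[ℝ] Coord n →L[ℝ] Coord n :=
  LinearMap.toContinuousBilinearMap <| LinearMap.mk₂ ℝ (christoffel h z)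
    (fun u u' v => by
      ext k
      simp [christoffel, koszul, ← mul_add, ← Finset.sum_add_distrib]
      exact Finset.sum_congr rfl fun _ _ => by ring)
    (fun a u v => by
      ext k
      simp [christoffel, koszul, Finset.mul_sum]
      exact Finset.sum_congr rfl fun _ _ => by ring)
    (fun u v v' => by
      ext k
      simp [christoffel, koszul, ← mul_add, ← Finset.sum_add_distrib]
      exact Finset.sum_congr rfl fun _ _ => by ring)
    (fun a u v => by
      ext k
      simp [christoffel, koszul, Finset.mul_sum]
      exact Finset.sum_congr rfl fun _ _ => by ring)

lemma christoffelCLM_apply {n : ℕ} (h : BilinField n) (z u v : Coord n) :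
    christoffelCLM h z u v = christoffel h z u v := rfl

set_option maxSynthPendingDepth 3 in
lemma IsMetricOn.contDiffOn_christoffelCLM {n : ℕ} {h : BilinField n} {W : Set (Coord n)}
    (hm : IsMetricOn h W) : ContDiffOn ℝ ∞ (christoffelCLM h) W := by
  refine contDiffOn_clm_apply.2 fun u => contDiffOn_clm_apply.2 fun v => ?_
  simp only [christoffelCLM_apply, christoffel]
  refine (contDiffOn_piLp 2).2 fun k => ?_
  have hd : ContDiffOn ℝ ∞ (fderiv ℝ h) W := hm.smooth.fderiv_of_isOpen hm.isOpen (by norm_num)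
  have h3 : ∀ a b c, ContDiffOn ℝ ∞ (fun z => fderiv ℝ h z a b c) W := fun a b c =>
    ((hd.clm_apply contDiffOn_const).clm_apply contDiffOn_const).clm_apply contDiffOn_const
  refine contDiffOn_const.mul (ContDiffOn.sum fun l _ => (hm.contDiffOn_gram_inv k l).mul ?_)
  exact ((h3 _ _ _).add (h3 _ _ _)).sub (h3 _ _ _)

/-- `L` is an isometric immersion of the open set `U` into the open set `W`. -/
structure LocalMap.IsIsometricOn {m n : ℕ} (L : LocalMap m n) (U : Set (Coord m))
    (W : Set (Coord n)) : Prop where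
  source : IsMetricOn L.g U
  target : IsMetricOn L.h W
  smooth : ContDiffOn ℝ ∞ L.F U
  mapsTo : Set.MapsTo L.F U W
  isometry : ∀ x ∈ U, ∀ u v, L.g x u v = L.h (L.F x) (fderiv ℝ L.F x u) (fderiv ℝ L.F x v)

/-! ### Covariant derivatives of vector fields along an immersion. -/

section Linear

variable {m n : ℕ} (L : LocalMap m n)

lemma LocalMap.cov_add_right (V : Coord m → Coord n) (x u v : Coord m) :
    L.cov V x (u + v) = L.cov V x u + L.cov V x v := by
  simp only [LocalMap.cov, ← christoffelCLM_apply, map_add, add_apply]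
  abel

lemma LocalMap.cov_smul_right (V : Coord m → Coord n) (x : Coord m) (a : ℝ) (u : Coord m) :
    L.cov V x (a • u) = a • L.cov V x u := by
  simp only [LocalMap.cov, ← christoffelCLM_apply, map_smul, smul_apply, smul_add]

lemma LocalMap.cov_congr {V V' : Coord m → Coord n} {U : Set (Coord m)} (hU : IsOpen U)
    (hV : Set.EqOn V V' U) {x : Coord m} (hx : x ∈ U) (u : Coord m) :
    L.cov V x u = L.cov V' x u := by
  have : V =ᶠ[nhds x] V' := Filter.eventuallyEq_of_mem (hU.mem_nhds hx) hV
  rw [LocalMap.cov, LocalMap.cov, this.fderiv_eq, hV hx]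

lemma LocalMap.cov_const_smul (a : ℝ) (V : Coord m → Coord n) (x u : Coord m) :
    L.cov (fun y => a • V y) x u = a • L.cov V x u := by
  have : fderiv ℝ (fun y => a • V y) x = a • fderiv ℝ V x :=
    congrFun (fderiv_const_smul_field (f := V) a) x
  simp only [LocalMap.cov, ← christoffelCLM_apply, map_smul, this, smul_apply, smul_add]

end Linear

namespace LocalMap.IsIsometricOn

variable {m n : ℕ} {L : LocalMap m n} {U : Set (Coord m)} {W : Set (Coord n)}
  (hL : L.IsIsometricOn U W)

include hL

lemma mono {V : Set (Coord m)} (hV : IsOpen V) (hVU : V ⊆ U) : L.IsIsometricOn V W where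
  source := ⟨hV, hL.source.smooth.mono hVU, fun z hz => hL.source.symm z (hVU hz),
    fun z hz => hL.source.pos z (hVU hz)⟩
  target := hL.target
  smooth := hL.smooth.mono hVU
  mapsTo := hL.mapsTo.mono_left hVU
  isometry := fun x hx => hL.isometry x (hVU hx)

lemma isOpen : IsOpen U := hL.source.isOpen

lemma diff {E : Type*} [NormedAddCommGroup E] [NormedSpace ℝ E] {V : Coord m → E}
    (hV : ContDiffOn ℝ ∞ V U) {x : Coord m} (hx : x ∈ U) : DifferentiableAt ℝ V x :=
  (hV.contDiffAt (hL.isOpen.mem_nhds hx)).differentiableAt (by simp)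

lemma contDiffOn_dF (v : Coord m) : ContDiffOn ℝ ∞ (fun x => fderiv ℝ L.F x v) U :=
  (hL.smooth.fderiv_of_isOpen hL.isOpen (by norm_num)).clm_apply contDiffOn_const

lemma contDiffOn_dF_field {w : Coord m → Coord m} (hw : ContDiffOn ℝ ∞ w U) :
    ContDiffOn ℝ ∞ (fun x => fderiv ℝ L.F x (w x)) U :=
  (hL.smooth.fderiv_of_isOpen hL.isOpen (by norm_num)).clm_apply hw

lemma contDiffOn_inner {V V' : Coord m → Coord n} (hV : ContDiffOn ℝ ∞ V U)
    (hV' : ContDiffOn ℝ ∞ V' U) : ContDiffOn ℝ ∞ (fun x => L.h (L.F x) (V x) (V' x)) U :=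
  ((hL.target.smooth.comp hL.smooth hL.mapsTo).clm_apply hV).clm_apply hV'

lemma contDiffOn_christoffel :
    ContDiffOn ℝ ∞ (fun x => christoffelCLM L.h (L.F x)) U :=
  hL.target.contDiffOn_christoffelCLM.comp hL.smooth hL.mapsTo

lemma contDiffOn_cov {V : Coord m → Coord n} (hV : ContDiffOn ℝ ∞ V U) (u : Coord m) :
    ContDiffOn ℝ ∞ (fun x => L.cov V x u) U :=
  ((hV.fderiv_of_isOpen hL.isOpen (by norm_num)).clm_apply contDiffOn_const).add
    ((hL.contDiffOn_christoffel.clm_apply (hL.contDiffOn_dF u)).clm_apply hV)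

lemma inner_comm {x : Coord m} (hx : x ∈ U) (P Q : Coord n) :
    L.h (L.F x) P Q = L.h (L.F x) Q P := hL.target.symm _ (hL.mapsTo hx) P Q

set_option maxSynthPendingDepth 3 in
lemma fderiv_inner {V V' : Coord m → Coord n} {x : Coord m} (hx : x ∈ U)
    (hV : DifferentiableAt ℝ V x) (hV' : DifferentiableAt ℝ V' x) (u : Coord m) :
    fderiv ℝ (fun y => L.h (L.F y) (V y) (V' y)) x u =
      L.h (L.F x) (L.cov V x u) (V' x) + L.h (L.F x) (V x) (L.cov V' x u) := by
  have h1 : HasFDerivAt (fun y => L.h (L.F y))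
      ((fderiv ℝ L.h (L.F x)).comp (fderiv ℝ L.F x)) x :=
    (hL.target.differentiableAt (hL.mapsTo hx)).hasFDerivAt.comp x
      (hL.diff hL.smooth hx).hasFDerivAt
  have h2 := (h1.clm_apply hV.hasFDerivAt).clm_apply hV'.hasFDerivAt
  rw [h2.fderiv]
  have h3 := hL.target.fderiv_metric (hL.mapsTo hx) (fderiv ℝ L.F x u) (V x) (V' x)
  simp [LocalMap.cov, h3]
  ring

lemma symm_snd {E : Type*} [NormedAddCommGroup E] [NormedSpace ℝ E] {V : Coord m → E}
    (hV : ContDiffOn ℝ ∞ V U) {x : Coord m} (hx : x ∈ U)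
    (u v : Coord m) : fderiv ℝ (fderiv ℝ V) x u v = fderiv ℝ (fderiv ℝ V) x v u := by
  have h1 := (hV.contDiffAt (hL.isOpen.mem_nhds hx)).isSymmSndFDerivAt (n := ∞)
    (by simpa using WithTop.coe_le_coe.2 (le_top (a := (2 : ℕ∞))))
  exact h1 u v

lemma fderiv_fderiv {E : Type*} [NormedAddCommGroup E] [NormedSpace ℝ E] {V : Coord m → E}
    (hV : ContDiffOn ℝ ∞ V U) {x : Coord m} (hx : x ∈ U)
    (u v : Coord m) : fderiv ℝ (fun y => fderiv ℝ V y v) x u = fderiv ℝ (fderiv ℝ V) x u v := by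
  have hd := hL.diff (hV.fderiv_of_isOpen (m := ∞) hL.isOpen (by norm_num)) hx
  rw [(hd.hasFDerivAt.clm_apply (hasFDerivAt_const v x)).fderiv]
  simp

lemma fderiv_comm {E : Type*} [NormedAddCommGroup E] [NormedSpace ℝ E] {V : Coord m → E}
    (hV : ContDiffOn ℝ ∞ V U) {x : Coord m} (hx : x ∈ U) (u v : Coord m) :
    fderiv ℝ (fun y => fderiv ℝ V y v) x u = fderiv ℝ (fun y => fderiv ℝ V y u) x v := by
  rw [hL.fderiv_fderiv hV hx, hL.fderiv_fderiv hV hx, hL.symm_snd hV hx]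

lemma cov_dF_comm {x : Coord m} (hx : x ∈ U) (u v : Coord m) :
    L.cov (fun y => fderiv ℝ L.F y v) x u = L.cov (fun y => fderiv ℝ L.F y u) x v := by
  simp only [LocalMap.cov]
  rw [hL.fderiv_comm hL.smooth hx, hL.target.christoffel_symm (hL.mapsTo hx)]

set_option maxSynthPendingDepth 3 in
lemma fderiv_christoffel_comp {A B : Coord m → Coord n} {x : Coord m} (hx : x ∈ U)
    (hA : DifferentiableAt ℝ A x) (hB : DifferentiableAt ℝ B x) (u : Coord m) :
    fderiv ℝ (fun y => christoffel L.h (L.F y) (A y) (B y)) x u =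
      fderiv ℝ (fun z => christoffel L.h z (A x) (B x)) (L.F x) (fderiv ℝ L.F x u)
      + christoffel L.h (L.F x) (fderiv ℝ A x u) (B x)
      + christoffel L.h (L.F x) (A x) (fderiv ℝ B x u) := by
  have hC : DifferentiableAt ℝ (christoffelCLM L.h) (L.F x) :=
    (hL.target.contDiffOn_christoffelCLM.contDiffAt
      (hL.target.isOpen.mem_nhds (hL.mapsTo hx))).differentiableAt (by simp)
  have h1 : HasFDerivAt (fun y => christoffelCLM L.h (L.F y))
      ((fderiv ℝ (christoffelCLM L.h) (L.F x)).comp (fderiv ℝ L.F x)) x :=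
    hC.hasFDerivAt.comp x (hL.diff hL.smooth hx).hasFDerivAt
  have h2 := (h1.clm_apply hA.hasFDerivAt).clm_apply hB.hasFDerivAt
  have h3 := (hC.hasFDerivAt.clm_apply (hasFDerivAt_const (A x) _)).clm_apply
    (hasFDerivAt_const (B x) _)
  simp only [christoffelCLM_apply] at h2 h3
  rw [h2.fderiv, h3.fderiv]
  simp [christoffelCLM_apply]
  abel

/-- Constant fields `u`, `v` commute, so the Ricci identity has no bracket term; every term with a
derivative of `V` is symmetric in `u`, `v` and cancels. -/
lemma cov_cov {V : Coord m → Coord n} (hV : ContDiffOn ℝ ∞ V U) {x : Coord m} (hx : x ∈ U)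
    (u v : Coord m) :
    L.cov (fun y => L.cov V y v) x u - L.cov (fun y => L.cov V y u) x v =
      curvature L.h (L.F x) (fderiv ℝ L.F x u) (fderiv ℝ L.F x v) (V x) := by
  have key : ∀ u v, L.cov (fun y => L.cov V y v) x u =
      fderiv ℝ (fun y => fderiv ℝ V y v) x u
      + fderiv ℝ (fun z => christoffel L.h z (fderiv ℝ L.F x v) (V x)) (L.F x) (fderiv ℝ L.F x u)
      + christoffel L.h (L.F x) (fderiv ℝ (fun y => fderiv ℝ L.F y v) x u) (V x)
      + christoffel L.h (L.F x) (fderiv ℝ L.F x v) (fderiv ℝ V x u)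
      + christoffel L.h (L.F x) (fderiv ℝ L.F x u) (fderiv ℝ V x v)
      + christoffel L.h (L.F x) (fderiv ℝ L.F x u)
          (christoffel L.h (L.F x) (fderiv ℝ L.F x v) (V x)) := by
    intro u v
    have hdV := hL.diff hV hx
    have hdF := hL.diff (hL.contDiffOn_dF v) hx
    have h1 : DifferentiableAt ℝ (fun y => fderiv ℝ V y v) x :=
      hL.diff ((hV.fderiv_of_isOpen (m := ∞) hL.isOpen (by norm_num)).clm_apply
        contDiffOn_const) hx
    have h2 : DifferentiableAt ℝ
        (fun y => christoffel L.h (L.F y) (fderiv ℝ L.F y v) (V y)) x :=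
      hL.diff ((hL.contDiffOn_christoffel.clm_apply (hL.contDiffOn_dF v)).clm_apply hV) hx
    simp only [LocalMap.cov]
    rw [fderiv_fun_add h1 h2, add_apply, hL.fderiv_christoffel_comp hx hdF hdV]
    simp only [← christoffelCLM_apply, map_add]
    abel
  rw [key, key, hL.fderiv_comm hV hx u v, hL.fderiv_comm hL.smooth hx u v, curvature]
  abel

/-- The second derivatives of the function `⟨V, V'⟩` commute; the products of first covariant
derivatives are symmetric and drop out. -/
lemma inner_curvature_antisymm_of_smooth {V V' : Coord m → Coord n} (hV : ContDiffOn ℝ ∞ V U)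
    (hV' : ContDiffOn ℝ ∞ V' U) {x : Coord m} (hx : x ∈ U) (u v : Coord m) :
    L.h (L.F x) (curvature L.h (L.F x) (fderiv ℝ L.F x u) (fderiv ℝ L.F x v) (V x)) (V' x)
      + L.h (L.F x) (V x)
        (curvature L.h (L.F x) (fderiv ℝ L.F x u) (fderiv ℝ L.F x v) (V' x)) = 0 := by
  have key : ∀ u v, fderiv ℝ (fun y => fderiv ℝ (fun y => L.h (L.F y) (V y) (V' y)) y v) x u =
      L.h (L.F x) (L.cov (fun y => L.cov V y v) x u) (V' x)
      + L.h (L.F x) (L.cov V x v) (L.cov V' x u) + L.h (L.F x) (L.cov V x u) (L.cov V' x v)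
      + L.h (L.F x) (V x) (L.cov (fun y => L.cov V' y v) x u) := by
    intro u v
    have e : (fun y => fderiv ℝ (fun y => L.h (L.F y) (V y) (V' y)) y v) =ᶠ[nhds x] fun y =>
        L.h (L.F y) (L.cov V y v) (V' y) + L.h (L.F y) (V y) (L.cov V' y v) := by
      filter_upwards [hL.isOpen.mem_nhds hx] with y hy
      exact hL.fderiv_inner hy (hL.diff hV hy) (hL.diff hV' hy) v
    have c1 := hL.contDiffOn_cov hV v
    have c2 := hL.contDiffOn_cov hV' v
    rw [e.fderiv_eq, fderiv_fun_add (hL.diff (hL.contDiffOn_inner c1 hV') hx)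
      (hL.diff (hL.contDiffOn_inner hV c2) hx), add_apply,
      hL.fderiv_inner hx (hL.diff c1 hx) (hL.diff hV' hx),
      hL.fderiv_inner hx (hL.diff hV hx) (hL.diff c2 hx)]
    ring
  have h1 := hL.fderiv_comm (hL.contDiffOn_inner hV hV') hx u v
  rw [key, key] at h1
  rw [← hL.cov_cov hV hx, ← hL.cov_cov hV' hx]
  simp only [map_sub, sub_apply]
  linarith

end LocalMap.IsIsometricOn

/-! ## Symmetries of the curvature tensor -/

/-- Through the identity map, identities for fields along an immersion become identities for a
metric alone. -/
lemma IsMetricOn.isIsometricOn_id {n : ℕ} {h : BilinField n} {W : Set (Coord n)}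
    (hm : IsMetricOn h W) : (⟨h, h, id⟩ : LocalMap n n).IsIsometricOn W W where
  source := hm
  target := hm
  smooth := contDiffOn_id
  mapsTo := Set.mapsTo_id W
  isometry := by simp

lemma curvature_swap {n : ℕ} (h : BilinField n) (z u v w : Coord n) :
    curvature h z u v w = -curvature h z v u w := by
  simp [curvature]

namespace IsMetricOn

variable {n : ℕ} {h : BilinField n} {W : Set (Coord n)} (hm : IsMetricOn h W)
  {z : Coord n} (hz : z ∈ W)

include hm hz

lemma curvature_antisymm (u v w w' : Coord n) :
    h z (curvature h z u v w) w' = -h z (curvature h z u v w') w := by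
  have h1 := hm.isIsometricOn_id.inner_curvature_antisymm_of_smooth (V := fun _ => w)
    (V' := fun _ => w') contDiffOn_const contDiffOn_const hz u v
  simp only [fderiv_id, id, ContinuousLinearMap.id_apply] at h1
  rw [hm.symm z hz w] at h1
  linarith

set_option maxSynthPendingDepth 3 in
lemma fderiv_christoffel (u v w : Coord n) :
    fderiv ℝ (fun y => christoffel h y v w) z u = fderiv ℝ (christoffelCLM h) z u v w := by
  have hC : DifferentiableAt ℝ (christoffelCLM h) z :=
    (hm.contDiffOn_christoffelCLM.contDiffAt (hm.isOpen.mem_nhds hz)).differentiableAt (by simp)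
  have h3 := (hC.hasFDerivAt.clm_apply (hasFDerivAt_const v _)).clm_apply (hasFDerivAt_const w _)
  simp only [christoffelCLM_apply] at h3
  rw [h3.fderiv]
  simp

set_option maxSynthPendingDepth 3 in
lemma curvature_eq (u v w : Coord n) :
    curvature h z u v w = fderiv ℝ (christoffelCLM h) z u v w
      + christoffelCLM h z u (christoffelCLM h z v w)
      - (fderiv ℝ (christoffelCLM h) z v u w
      + christoffelCLM h z v (christoffelCLM h z u w)) := by
  simp only [curvature, hm.fderiv_christoffel hz, christoffelCLM_apply]

/-- Symmetry of `Γ`, and hence of its derivative, in the lower slots makes the cyclic sum cancel in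
pairs. -/
lemma curvature_bianchi (u v w : Coord n) :
    curvature h z u v w + curvature h z v w u + curvature h z w u v = 0 := by
  have hs : ∀ u v w, fderiv ℝ (christoffelCLM h) z u v w = fderiv ℝ (christoffelCLM h) z u w v := by
    intro u v w
    rw [← hm.fderiv_christoffel hz, ← hm.fderiv_christoffel hz]
    congr 1
    apply Filter.EventuallyEq.fderiv_eq
    filter_upwards [hm.isOpen.mem_nhds hz] with y hy using hm.christoffel_symm hy v w
  have hs' : ∀ u v, christoffelCLM h z u v = christoffelCLM h z v u :=
    fun u v => hm.christoffel_symm hz u v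
  rw [hm.curvature_eq hz, hm.curvature_eq hz, hm.curvature_eq hz, hs u v w, hs v w u, hs w u v,
    hs' v w, hs' w u, hs' u v]
  abel

end IsMetricOn

/-- A tensor with the symmetries of the curvature tensor is determined by its sectional
curvatures. -/
lemma eq_zero_of_sectional_eq_zero {E : Type*} [AddCommGroup E] (T : E → E → E → E → ℝ)
    (add₁ : ∀ x x' y z w, T (x + x') y z w = T x y z w + T x' y z w)
    (antisymm₁₂ : ∀ x y z w, T x y z w = -T y x z w)
    (antisymm₃₄ : ∀ x y z w, T x y z w = -T x y w z)
    (bianchi : ∀ x y z w, T x y z w + T y z x w + T z x y w = 0)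
    (sec : ∀ x y, T x y y x = 0) (x y z w : E) : T x y z w = 0 := by
  -- Pair symmetry: the four Bianchi identities obtained by cyclically permuting the arguments,
  -- combined through the two antisymmetries. It carries additivity from the first slot to the
  -- third.
  have pair : ∀ x y z w, T x y z w = T z w x y := by
    intro x y z w
    linarith [bianchi x y z w, bianchi y z w x, bianchi z w x y, bianchi w x y z,
      antisymm₁₂ x y z w, antisymm₁₂ y z x w, antisymm₁₂ z x y w, antisymm₃₄ x y z w,
      antisymm₃₄ y z w x, antisymm₃₄ z w y x, antisymm₁₂ w y z x, antisymm₃₄ w y z x,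
      antisymm₃₄ z w x y, antisymm₃₄ w x z y, antisymm₁₂ w x z y, antisymm₁₂ x z w y,
      antisymm₃₄ x z w y, antisymm₃₄ x y w z, antisymm₁₂ y w x z, antisymm₃₄ y w x z,
      antisymm₃₄ w x y z]
  have add₃ : ∀ x y z z' w, T x y (z + z') w = T x y z w + T x y z' w := by
    intro x y z z' w
    rw [pair, add₁, pair z, pair z']
  have add₄ : ∀ x y z w w', T x y z (w + w') = T x y z w + T x y z w' := by
    intro x y z w w'
    linarith [antisymm₃₄ x y z (w + w'), antisymm₃₄ x y z w, antisymm₃₄ x y z w', add₃ x y w w' z]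
  have add₂ : ∀ x y y' z w, T x (y + y') z w = T x y z w + T x y' z w := by
    intro x y y' z w
    linarith [antisymm₁₂ x (y + y') z w, antisymm₁₂ x y z w, antisymm₁₂ x y' z w, add₁ y y' x z w]
  -- Polarisation of `sec` in the outer argument; `s2` then polarises in the inner one.
  have s1 : ∀ x y w, T x y y w = 0 := by
    intro x y w
    have h1 := sec (x + w) y
    rw [add₁, add₄, add₄, sec, sec] at h1
    linarith [pair w y y x, antisymm₁₂ y x w y, antisymm₃₄ x y w y]
  have s2 : ∀ x y z w, T x y z w = -T x z y w := by
    intro x y z w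
    have h1 := s1 x (y + z) w
    rw [add₂, add₃, add₃, s1, s1] at h1
    linarith
  -- Antisymmetry in adjacent slots makes the three Bianchi terms equal, so `3 T = 0`.
  linarith [bianchi x y z w, s2 y z x w, antisymm₁₂ y x z w, antisymm₁₂ z x y w, s2 x z y w]

lemma IsMetricOn.inner_curvature_of_sectional {n : ℕ} {h : BilinField n} {W : Set (Coord n)}
    (hm : IsMetricOn h W) {z : Coord n} (hz : z ∈ W) {c : ℝ}
    (hc : ∀ u v, LinearIndependent ℝ ![u, v] → sectional h z u v = c) (x y u w : Coord n) :
    h z (curvature h z x y u) w = c * (h z y u * h z x w - h z x u * h z y w) := by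
  -- The tensor tested is the difference between the curvature and its constant-curvature model.
  have key := eq_zero_of_sectional_eq_zero
    (fun x y u w => h z (curvature h z x y u) w - c * (h z y u * h z x w - h z x u * h z y w))
    ?_ ?_ ?_ ?_ ?_ x y u w
  · linarith
  · intro x x' y u w
    simp only [hm.curvature_eq hz, map_add, add_apply, map_sub, sub_apply]
    ring
  · intro x y u w
    simp only [curvature_swap h z x y, map_neg, neg_apply]
    ring
  · intro x y u w
    simp only [hm.curvature_antisymm hz x y u w]
    ring
  · intro x y u w
    have h1 := congrArg (fun q => h z q w) (hm.curvature_bianchi hz x y u)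
    simp only [map_add, add_apply, map_zero, zero_apply] at h1
    simp only [hm.symm z hz u x, hm.symm z hz u y, hm.symm z hz y x]
    linear_combination h1
  · intro x y
    by_cases hli : LinearIndependent ℝ ![x, y]
    · have h1 := hc x y hli
      have hden : h z x x * h z y y - h z x y ^ 2 ≠ 0 := by
        have hy : y ≠ 0 := by simpa using hli.ne_zero 1
        have hyy := hm.pos z hz y hy
        -- The squared length of this vector is `⟨y, y⟩` times the Gram determinant of `x, y`, which
        -- is therefore positive.
        have hv : h z y y • x - h z x y • y ≠ 0 := by
          intro h0
          have := LinearIndependent.pair_iff.1 hli (h z y y) (-h z x y) (by rw [← h0]; module)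
          exact hyy.ne' this.1
        have h2 := hm.pos z hz _ hv
        simp only [map_sub, sub_apply, map_smul, smul_apply, smul_eq_mul, hm.symm z hz y x] at h2
        intro h0
        have h3 : h z y y * (h z x x * h z y y - h z x y ^ 2) = 0 := by rw [h0, mul_zero]
        nlinarith
      rw [sectional, div_eq_iff hden] at h1
      simp only [h1, hm.symm z hz y x]
      ring
    -- The curvature hypothesis is silent on dependent pairs; there both tensors vanish.
    · rw [LinearIndependent.pair_iff] at hli
      push Not at hli
      obtain ⟨s, t, hst, hne⟩ := hli
      have hself : ∀ v w, curvature h z v v w = 0 := fun v w => by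
        simp [curvature]
      by_cases ht : t = 0
      · have hs : s ≠ 0 := fun hs => hne hs ht
        have hx : x = 0 := by simpa [ht, hs] using hst
        subst hx
        simp
      · have hy : y = (-s / t) • x := by
          rw [div_eq_inv_mul, mul_smul, eq_inv_smul_iff₀ ht]
          linear_combination (norm := module) hst
        have h1 : curvature h z x y y = 0 := by
          rw [curvature_eq hm hz]
          have := hself x y
          rw [curvature_eq hm hz] at this
          rw [hy] at this ⊢
          simp only [map_smul, smul_apply] at this ⊢
          linear_combination (norm := module) (-s / t) • this
        rw [h1]
        have h2 : h z y y * h z x x = h z x y * h z y x := by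
          rw [hy]; simp; ring
        simp only [map_zero, zero_apply]
        rw [h2]; ring

/-! ## Orthonormal bases -/

namespace IsMetricOn

variable {n : ℕ} {h : BilinField n} {W : Set (Coord n)} (hm : IsMetricOn h W)
  {z : Coord n} (hz : z ∈ W) {e : Fin n → Coord n}
  (he : ∀ a b, h z (e a) (e b) = if a = b then 1 else 0)

include hm hz he

-- With the `e a` as columns of `Q`, orthonormality is `Qᵀ G Q = 1`, hence `G⁻¹ = Q Qᵀ`.
omit hm hz in
lemma gram_inv_eq_sum (i j : Fin n) : (gram h z)⁻¹ i j = ∑ a, e a i * e a j := by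
  let Q : Matrix (Fin n) (Fin n) ℝ := Matrix.of fun i a => e a i
  have h1 : Q.transpose * gram h z * Q = 1 := by
    ext a b
    rw [Matrix.mul_assoc, Matrix.mul_apply, Matrix.one_apply, ← he a b]
    have : ∀ j, (gram h z * Q) j b = h z (bvec j) (e b) := fun j => gram_mulVec h z _ j
    simp only [this]
    conv_rhs => rw [← sum_bvec (e a)]
    simp [Q]
  have h2 : Q * Q.transpose * gram h z = 1 := by
    rw [Matrix.mul_assoc]
    exact mul_eq_one_comm.1 h1
  rw [Matrix.inv_eq_left_inv h2, Matrix.mul_apply]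
  rfl

omit hm hz in
lemma sum_gram_inv (b : Coord n → Coord n → ℝ)
    (hb₁ : ∀ f : Fin n → ℝ, ∀ v, b (∑ i, f i • bvec i) v = ∑ i, f i * b (bvec i) v)
    (hb₂ : ∀ f : Fin n → ℝ, ∀ u, b u (∑ i, f i • bvec i) = ∑ i, f i * b u (bvec i)) :
    ∑ i, ∑ j, (gram h z)⁻¹ i j * b (bvec i) (bvec j) = ∑ a, b (e a) (e a) := by
  have : ∀ a, b (e a) (e a) = ∑ i, ∑ j, (e a i * e a j) * b (bvec i) (bvec j) := by
    intro a
    conv_lhs => rw [← sum_bvec (e a)]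
    simp only [hb₁, hb₂, Finset.mul_sum, mul_assoc]
  simp only [this, gram_inv_eq_sum he, Finset.sum_mul]
  rw [Finset.sum_comm]
  rw [Finset.sum_comm]
  conv_rhs => rw [Finset.sum_comm]; enter [2, i]; rw [Finset.sum_comm]

lemma sum_inner_smul (u : Coord n) : ∑ a, h z u (e a) • e a = u := by
  conv_rhs => rw [← hm.sum_gram_inv_inner hz u]
  simp only [gram_inv_eq_sum he]
  have : ∀ a, h z u (e a) • e a = ∑ i, ∑ j, (e a i * e a j * h z u (bvec i)) • bvec j := by
    intro a
    conv_lhs => rw [← sum_bvec (e a)]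
    simp only [map_sum, map_smul, Finset.sum_smul, Finset.smul_sum, smul_smul, smul_eq_mul,
      Finset.sum_mul]
    rw [Finset.sum_comm]
    exact Finset.sum_congr rfl fun i _ => Finset.sum_congr rfl fun j _ => by congr 1; ring
  simp only [this, Finset.sum_mul, Finset.sum_smul]
  rw [Finset.sum_comm]
  exact Finset.sum_congr rfl fun i _ => Finset.sum_comm

lemma inner_eq_sum (u v : Coord n) : h z u v = ∑ a, h z u (e a) * h z v (e a) := by
  conv_lhs => rw [← hm.sum_inner_smul hz he v]
  simp [mul_comm]

end IsMetricOn

/-! ## Extrinsic geometry of a local immersion -/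

lemma LocalMap.sum_gram_inv_inner_secondFF
    {m n : ℕ} (L : LocalMap m n) (x : Coord m) (hm : m ≠ 0) (η : Coord n) :
    ∑ i, ∑ j, (gram L.g x)⁻¹ i j * L.h (L.F x) (L.secondFF x (bvec i) (bvec j)) η =
      m * L.h (L.F x) (L.meanCurv x) η := by
  have : (m : ℝ) ≠ 0 := by exact_mod_cast hm
  simp [LocalMap.meanCurv, this]

namespace LocalMap.IsIsometricOn

variable {m n : ℕ} {L : LocalMap m n} {U : Set (Coord m)} {W : Set (Coord n)}
  (hL : L.IsIsometricOn U W) {x : Coord m} (hx : x ∈ U)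

include hL

lemma contDiffOn_normalPart {V : Coord m → Coord n} (hV : ContDiffOn ℝ ∞ V U) :
    ContDiffOn ℝ ∞ (fun x => L.normalPart x (V x)) U := by
  refine hV.sub (ContDiffOn.sum fun i _ => ContDiffOn.sum fun j _ => ?_)
  exact ((hL.source.contDiffOn_gram_inv i j).mul (hL.contDiffOn_inner hV
    (hL.contDiffOn_dF _))).smul (hL.contDiffOn_dF _)

lemma contDiffOn_meanCurv : ContDiffOn ℝ ∞ L.meanCurv U := by
  refine (ContDiffOn.sum fun i _ => ContDiffOn.sum fun j _ => ?_).const_smul _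
  exact (hL.source.contDiffOn_gram_inv i j).smul
    (hL.contDiffOn_normalPart (hL.contDiffOn_cov (hL.contDiffOn_dF _) _))

include hx

/-- The vector `t` is the metric dual of `v ↦ ⟨P, dF v⟩`, obtained by raising the index with `g⁻¹`;
its image is the tangential part of `P`. -/
lemma exists_normalPart_eq (P : Coord n) :
    ∃ t, L.normalPart x P = P - fderiv ℝ L.F x t ∧
      ∀ v, L.g x t v = L.h (L.F x) P (fderiv ℝ L.F x v) := by
  refine ⟨WithLp.toLp 2 fun k => ∑ l, (gram L.g x)⁻¹ k l * L.h (L.F x) P (fderiv ℝ L.F x (bvec l)),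
    ?_, fun v => ?_⟩
  · rw [coord_eq_sum_bvec, LocalMap.normalPart, Finset.sum_comm]
    simp [Finset.sum_smul, hL.source.gram_inv_symm hx]
  · conv_lhs => rw [← sum_bvec v]
    conv_rhs => rw [← sum_bvec v]
    simp only [map_sum, map_smul]
    refine Finset.sum_congr rfl fun j _ => ?_
    rw [hL.source.inner_gram_inv hx]

lemma inner_normalPart_dF (P : Coord n) (v : Coord m) :
    L.h (L.F x) (L.normalPart x P) (fderiv ℝ L.F x v) = 0 := by
  obtain ⟨t, h1, h2⟩ := hL.exists_normalPart_eq hx P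
  rw [h1, map_sub, sub_apply, ← hL.isometry x hx, h2, sub_self]

lemma inner_normalPart (P : Coord n) {η : Coord n}
    (hη : ∀ v, L.h (L.F x) η (fderiv ℝ L.F x v) = 0) :
    L.h (L.F x) (L.normalPart x P) η = L.h (L.F x) P η := by
  obtain ⟨t, h1, h2⟩ := hL.exists_normalPart_eq hx P
  rw [h1, map_sub, sub_apply, hL.inner_comm hx (fderiv ℝ L.F x t), hη, sub_zero]

lemma inner_meanCurv_dF (v : Coord m) :
    L.h (L.F x) (L.meanCurv x) (fderiv ℝ L.F x v) = 0 := by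
  simp [LocalMap.meanCurv, LocalMap.secondFF, hL.inner_normalPart_dF hx]

/-- The derivative of `⟨dF v, η⟩ = 0`. -/
lemma inner_cov_normal {η : Coord m → Coord n} (hη : ContDiffOn ℝ ∞ η U)
    (hn : ∀ y ∈ U, ∀ v, L.h (L.F y) (η y) (fderiv ℝ L.F y v) = 0) (u v : Coord m) :
    L.h (L.F x) (L.cov (fun y => fderiv ℝ L.F y v) x u) (η x) =
      -L.h (L.F x) (fderiv ℝ L.F x v) (L.cov η x u) := by
  have h1 := hL.fderiv_inner hx (hL.diff (hL.contDiffOn_dF v) hx) (hL.diff hη hx) u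
  have h2 : (fun y => L.h (L.F y) (fderiv ℝ L.F y v) (η y)) =ᶠ[nhds x] fun _ => 0 := by
    filter_upwards [hL.isOpen.mem_nhds hx] with y hy
    rw [hL.inner_comm hy, hn y hy]
  rw [h2.fderiv_eq] at h1
  simp at h1
  linarith

lemma fderiv_source_metric (u v w : Coord m) :
    fderiv ℝ L.g x u v w =
      L.h (L.F x) (L.cov (fun y => fderiv ℝ L.F y v) x u) (fderiv ℝ L.F x w)
      + L.h (L.F x) (fderiv ℝ L.F x v) (L.cov (fun y => fderiv ℝ L.F y w) x u) := by
  rw [← hL.fderiv_inner hx (hL.diff (hL.contDiffOn_dF v) hx) (hL.diff (hL.contDiffOn_dF w) hx)]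
  have h2 : (fun y => L.h (L.F y) (fderiv ℝ L.F y v) (fderiv ℝ L.F y w)) =ᶠ[nhds x]
      fun y => L.g y v w := by
    filter_upwards [hL.isOpen.mem_nhds hx] with y hy using (hL.isometry y hy v w).symm
  rw [h2.fderiv_eq]
  have h3 := ((hL.source.differentiableAt hx).hasFDerivAt.clm_apply
    (hasFDerivAt_const v x)).clm_apply (hasFDerivAt_const w x)
  rw [h3.fderiv]
  simp

/-- The tangential part of the connection along `F` is the Levi-Civita connection of the source. -/
lemma inner_cov_dF (u v w : Coord m) :
    L.h (L.F x) (L.cov (fun y => fderiv ℝ L.F y v) x u) (fderiv ℝ L.F x w) =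
      L.g x (christoffel L.g x u v) w := by
  have h1 := hL.source.inner_christoffel hx u v w
  rw [koszul, hL.fderiv_source_metric hx, hL.fderiv_source_metric hx,
    hL.fderiv_source_metric hx, hL.cov_dF_comm hx w u, hL.cov_dF_comm hx w v,
    hL.cov_dF_comm hx v u] at h1
  have h2 := hL.inner_comm hx (fderiv ℝ L.F x v) (L.cov (fun y => fderiv ℝ L.F y w) x u)
  have h3 := hL.inner_comm hx (fderiv ℝ L.F x u) (L.cov (fun y => fderiv ℝ L.F y w) x v)
  linarith

/-- The second fundamental form is symmetric. -/
lemma secondFF_symm (u v : Coord m) : L.secondFF x u v = L.secondFF x v u := by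
  rw [LocalMap.secondFF, LocalMap.secondFF, hL.cov_dF_comm hx]

/-- The Gauss formula. -/
lemma secondFF_eq (u v : Coord m) : L.secondFF x u v =
    L.cov (fun y => fderiv ℝ L.F y v) x u - fderiv ℝ L.F x (christoffel L.g x u v) := by
  obtain ⟨t, h1, h2⟩ := hL.exists_normalPart_eq hx (L.cov (fun y => fderiv ℝ L.F y v) x u)
  rw [LocalMap.secondFF, h1]
  congr 2
  exact hL.source.ext_inner hx fun w => by rw [h2, hL.inner_cov_dF hx]

end LocalMap.IsIsometricOn

/-! ## Derivative of a trace -/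

lemma fderiv_sum_mul {E ι : Type*} [NormedAddCommGroup E] [NormedSpace ℝ E] (s : Finset ι)
    {a b : ι → E → ℝ} {x : E} (ha : ∀ k, DifferentiableAt ℝ (a k) x)
    (hb : ∀ k, DifferentiableAt ℝ (b k) x) (v : E) :
    fderiv ℝ (fun y => ∑ k ∈ s, a k y * b k y) x v =
      ∑ k ∈ s, (fderiv ℝ (a k) x v * b k x + a k x * fderiv ℝ (b k) x v) := by
  have h1 : HasFDerivAt (fun y => ∑ k ∈ s, a k y * b k y)
      (∑ k ∈ s, (a k x • fderiv ℝ (b k) x + b k x • fderiv ℝ (a k) x)) x :=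
    HasFDerivAt.fun_sum fun k _ => (ha k).hasFDerivAt.mul (hb k).hasFDerivAt
  rw [h1.fderiv]
  simp only [sum_apply, add_apply, smul_apply, smul_eq_mul]
  exact Finset.sum_congr rfl fun k _ => by ring

/-- This is `∇ g⁻¹ = 0`, found by differentiating `g⁻¹ g = 1` and inserting metric compatibility for
the derivative of `g`. -/
lemma IsMetricOn.fderiv_gram_inv {n : ℕ} {g : BilinField n} {U : Set (Coord n)}
    (hm : IsMetricOn g U) {x : Coord n} (hx : x ∈ U) (v : Coord n) (i j : Fin n) :
    fderiv ℝ (fun y => (gram g y)⁻¹ i j) x v =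
      -(∑ k, (gram g x)⁻¹ i k * christoffel g x v (bvec k) j)
        - ∑ k, christoffel g x v (bvec k) i * (gram g x)⁻¹ k j := by
  have hP : ∀ i j, DifferentiableAt ℝ (fun y => (gram g y)⁻¹ i j) x := fun i j =>
    ((hm.contDiffOn_gram_inv i j).contDiffAt (hm.isOpen.mem_nhds hx)).differentiableAt (by simp)
  have hG : ∀ i j, HasFDerivAt (fun y => gram g y i j)
      (((fderiv ℝ g x).flip (bvec i)).flip (bvec j)) x := fun i j => by
    have h3 := ((hm.differentiableAt hx).hasFDerivAt.clm_apply
      (hasFDerivAt_const (bvec i) x)).clm_apply (hasFDerivAt_const (bvec j) x)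
    refine h3.congr_fderiv ?_
    ext
    simp
  let P := (gram g x)⁻¹
  let G := gram g x
  let M : Matrix (Fin n) (Fin n) ℝ := Matrix.of fun p k => christoffel g x v (bvec p) k
  let P' : Matrix (Fin n) (Fin n) ℝ := Matrix.of fun i j => fderiv ℝ (fun y => (gram g y)⁻¹ i j) x v
  have hGP : G * P = 1 := Matrix.mul_nonsing_inv _ (hm.isUnit_det hx)
  have hPG : P * G = 1 := Matrix.nonsing_inv_mul _ (hm.isUnit_det hx)
  have hG' : ∀ i j, fderiv ℝ (fun y => gram g y i j) x v = (M * G + G * M.transpose) i j := by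
    intro i j
    rw [(hG i j).fderiv]
    simp only [ContinuousLinearMap.flip_apply, hm.fderiv_metric hx]
    rw [Matrix.add_apply, Matrix.mul_apply, Matrix.mul_apply]
    congr 1
    · conv_lhs => rw [← sum_bvec (christoffel g x v (bvec i))]
      simp [M, G, gram]
    · conv_lhs => rw [← sum_bvec (christoffel g x v (bvec j))]
      simp [M, G, gram, mul_comm]
  have h1 : P' * G + P * (M * G + G * M.transpose) = 0 := by
    ext i j
    have e : (fun y => ∑ k, (gram g y)⁻¹ i k * gram g y k j) =ᶠ[nhds x]
        fun _ => (1 : Matrix (Fin n) (Fin n) ℝ) i j := by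
      filter_upwards [hm.isOpen.mem_nhds hx] with y hy
      rw [← Matrix.mul_apply, Matrix.nonsing_inv_mul _ (hm.isUnit_det hy)]
    have h3 : fderiv ℝ (fun y => ∑ k, (gram g y)⁻¹ i k * gram g y k j) x v = 0 := by
      rw [e.fderiv_eq]; simp
    rw [fderiv_sum_mul Finset.univ (b := fun k y => gram g y k j) (hP i)
      fun k => (hG k j).differentiableAt] at h3
    rw [Matrix.add_apply, Matrix.mul_apply, Matrix.mul_apply, ← Finset.sum_add_distrib,
      Matrix.zero_apply, ← h3]
    exact Finset.sum_congr rfl fun k _ => by rw [hG']; rfl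
  have h2 : P' = -(P * M) - M.transpose * P := by
    have h3 : (P' * G + P * (M * G + G * M.transpose)) * P = 0 := by rw [h1, zero_mul]
    have h4 : (P' * G + P * (M * G + G * M.transpose)) * P =
        P' * (G * P) + (P * M * (G * P) + P * G * M.transpose * P) := by noncomm_ring
    rw [h4, hGP, hPG, mul_one, mul_one, one_mul] at h3
    rw [← sub_eq_zero, ← h3]
    abel
  have h3 := congrFun (congrFun h2 i) j
  rw [Matrix.sub_apply, Matrix.neg_apply, Matrix.mul_apply, Matrix.mul_apply] at h3
  exact h3

/-- Contraction commutes with covariant differentiation: the Christoffel terms from `g⁻¹` are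
reindexed onto the slots of `T`. -/
lemma IsMetricOn.fderiv_sum_gram_inv {g : BilinField 2} {U : Set (Coord 2)}
    (hm : IsMetricOn g U) {x : Coord 2} (hx : x ∈ U) (T : Coord 2 → Fin 2 → Fin 2 → ℝ)
    (hT : ∀ i j, DifferentiableAt ℝ (fun y => T y i j) x) (v : Coord 2) :
    fderiv ℝ (fun y => ∑ i, ∑ j, (gram g y)⁻¹ i j * T y i j) x v =
      ∑ i, ∑ j, (gram g x)⁻¹ i j * (fderiv ℝ (fun y => T y i j) x v
        - ∑ k, christoffel g x v (bvec i) k * T x k j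
        - ∑ k, christoffel g x v (bvec j) k * T x i k) := by
  have hP : ∀ i j, DifferentiableAt ℝ (fun y => (gram g y)⁻¹ i j) x := fun i j =>
    ((hm.contDiffOn_gram_inv i j).contDiffAt (hm.isOpen.mem_nhds hx)).differentiableAt (by simp)
  have e : (fun y => ∑ i, ∑ j, (gram g y)⁻¹ i j * T y i j) =
      fun y => ∑ k : Fin 2 × Fin 2, (gram g y)⁻¹ k.1 k.2 * T y k.1 k.2 := by
    funext y
    rw [Fintype.sum_prod_type]
  have h1 := fderiv_sum_mul Finset.univ (a := fun (k : Fin 2 × Fin 2) y => (gram g y)⁻¹ k.1 k.2)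
    (b := fun k y => T y k.1 k.2) (fun k => hP _ _) (fun k => hT _ _) v
  rw [e, h1]
  simp only [hm.fderiv_gram_inv hx, Fintype.sum_prod_type]
  generalize (gram g x)⁻¹ = P
  generalize hΓ : (fun k i => (christoffel g x v (bvec k)).ofLp i) = Γ
  generalize hT' : (fun i j => fderiv ℝ (fun y => T y i j) x v) = T'
  have eΓ : ∀ k i, (christoffel g x v (bvec k)).ofLp i = Γ k i := fun k i => by rw [← hΓ]
  have eT' : ∀ i j, fderiv ℝ (fun y => T y i j) x v = T' i j := fun i j => by rw [← hT']
  simp only [eΓ, eT']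
  generalize T x = S
  clear hΓ hT' eΓ eT' h1 e hP hT
  simp only [Fin.sum_univ_two]
  ring

lemma LocalMap.cov_sum {m n : ℕ} (L : LocalMap m n) (V : Coord m → Coord n) (x : Coord m)
    {ι : Type*} (s : Finset ι) (f : ι → ℝ) (w : ι → Coord m) :
    L.cov V x (∑ i ∈ s, f i • w i) = ∑ i ∈ s, f i • L.cov V x (w i) := by
  let T : Coord m →ₗ[ℝ] Coord n :=
    { toFun := L.cov V x
      map_add' := L.cov_add_right V x
      map_smul' := L.cov_smul_right V x }
  have : ∀ u, L.cov V x u = T u := fun _ => rfl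
  simp only [this, map_sum, map_smul]

/-- The second fundamental form in the direction of a normal field `η`, through the Weingarten
formula. -/
def LocalMap.weingarten {m n : ℕ} (L : LocalMap m n) (η : Coord m → Coord n) (x u v : Coord m) :
    ℝ :=
  -L.h (L.F x) (fderiv ℝ L.F x v) (L.cov η x u)

namespace LocalMap.IsIsometricOn

/-! ### Weingarten form and Codazzi equation. -/

section Normal

variable {m n : ℕ} {L : LocalMap m n} {U : Set (Coord m)} {W : Set (Coord n)}
  (hL : L.IsIsometricOn U W) {η : Coord m → Coord n} (hη : ContDiffOn ℝ ∞ η U)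
  (hn : ∀ y ∈ U, ∀ v, L.h (L.F y) (η y) (fderiv ℝ L.F y v) = 0)
  {x : Coord m} (hx : x ∈ U)

include hL hη

lemma contDiffOn_weingarten (u v : Coord m) :
    ContDiffOn ℝ ∞ (fun x => L.weingarten η x u v) U :=
  (hL.contDiffOn_inner (hL.contDiffOn_dF v) (hL.contDiffOn_cov hη u)).neg

include hx

include hn

lemma inner_secondFF (u v : Coord m) :
    L.h (L.F x) (L.secondFF x u v) (η x) = L.weingarten η x u v := by
  rw [LocalMap.secondFF, hL.inner_normalPart hx _ (hn x hx), hL.inner_cov_normal hx hη hn]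
  rfl

lemma weingarten_symm (u v : Coord m) : L.weingarten η x u v = L.weingarten η x v u := by
  rw [← hL.inner_secondFF hη hn hx, ← hL.inner_secondFF hη hn hx, LocalMap.secondFF,
    LocalMap.secondFF, hL.cov_dF_comm hx]

/-- The Codazzi equation. -/
lemma fderiv_weingarten {c : ℝ}
    (hc : ∀ z ∈ W, ∀ u v, LinearIndependent ℝ ![u, v] → sectional L.h z u v = c)
    (i j v : Coord m) :
    fderiv ℝ (fun y => L.weingarten η y j v) x i = fderiv ℝ (fun y => L.weingarten η y i j) x v
      + L.h (L.F x) (L.cov (fun y => fderiv ℝ L.F y j) x v) (L.cov η x i)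
      - L.h (L.F x) (L.cov (fun y => fderiv ℝ L.F y j) x i) (L.cov η x v) := by
  -- After this swap both sides differentiate `-⟨dF j, ∇η⟩`, so their difference involves the
  -- commutator of covariant derivatives of `η`.
  have e : (fun y => L.weingarten η y j v) =ᶠ[nhds x] fun y => L.weingarten η y v j := by
    filter_upwards [hL.isOpen.mem_nhds hx] with y hy using hL.weingarten_symm hη hn hy j v
  have key : ∀ i v, fderiv ℝ (fun y => L.weingarten η y v j) x i =
      -(L.h (L.F x) (L.cov (fun y => fderiv ℝ L.F y j) x i) (L.cov η x v)
      + L.h (L.F x) (fderiv ℝ L.F x j) (L.cov (fun y => L.cov η y v) x i)) := by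
    intro i v
    rw [← hL.fderiv_inner hx (hL.diff (hL.contDiffOn_dF j) hx)
      (hL.diff (hL.contDiffOn_cov hη v) hx)]
    simp only [LocalMap.weingarten]
    rw [fderiv_fun_neg, neg_apply]
  -- The curvature term `⟨dF j, R(i, v)η⟩` vanishes: in constant curvature it is a combination of
  -- `⟨η, dF i⟩` and `⟨η, dF v⟩`.
  have h1 := congrArg (L.h (L.F x) (fderiv ℝ L.F x j)) (hL.cov_cov hη hx i v)
  rw [hL.inner_comm hx _ (curvature _ _ _ _ _),
    hL.target.inner_curvature_of_sectional (hL.mapsTo hx) (hc _ (hL.mapsTo hx)),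
    hL.inner_comm hx _ (η x), hL.inner_comm hx _ (η x), hn x hx, hn x hx, map_sub] at h1
  rw [e.fderiv_eq, key, key]
  linarith

end Normal

/-! ### The biconservative equation for constant `|H|`. -/

section Biconservative

variable {n : ℕ} {L : LocalMap 2 n} {U : Set (Coord 2)} {W : Set (Coord n)}
  (hL : L.IsIsometricOn U W) {κ : ℝ} (hκ : ∀ y ∈ U, L.normMeanCurv y = κ)
  {x : Coord 2} (hx : x ∈ U)

include hL hκ hx

lemma inner_meanCurv_self : L.h (L.F x) (L.meanCurv x) (L.meanCurv x) = κ ^ 2 := by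
  rw [← hκ x hx, LocalMap.normMeanCurv, Real.sq_sqrt (hL.target.nonneg (hL.mapsTo hx) _)]

lemma inner_cov_meanCurv (u : Coord 2) :
    L.h (L.F x) (L.cov L.meanCurv x u) (L.meanCurv x) = 0 := by
  have hd := hL.diff hL.contDiffOn_meanCurv hx
  have h1 := hL.fderiv_inner hx hd hd u
  have h2 : (fun y => L.h (L.F y) (L.meanCurv y) (L.meanCurv y)) =ᶠ[nhds x] fun _ => κ ^ 2 := by
    filter_upwards [hL.isOpen.mem_nhds hx] with y hy using hL.inner_meanCurv_self hκ hy
  rw [h2.fderiv_eq, hL.inner_comm hx (L.meanCurv x)] at h1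
  simp at h1
  linarith

omit hκ in
lemma sum_gram_inv_weingarten_meanCurv : ∑ i, ∑ j, (gram L.g x)⁻¹ i j *
    L.weingarten L.meanCurv x (bvec i) (bvec j) = 2 * L.h (L.F x) (L.meanCurv x) (L.meanCurv x) := by
  have h1 := L.sum_gram_inv_inner_secondFF x two_ne_zero (L.meanCurv x)
  simp only [hL.inner_secondFF hL.contDiffOn_meanCurv
    (fun y hy => hL.inner_meanCurv_dF hy) hx] at h1
  exact_mod_cast h1

/-- For a surface with `|H|` constant in a space form, `Div S₂ = 0` reads
`trace ⟨B(v, ·), ∇^⊥_· H⟩ = 0`. -/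
lemma divergence_stressBienergy {c : ℝ}
    (hc : ∀ z ∈ W, ∀ u v, LinearIndependent ℝ ![u, v] → sectional L.h z u v = c) (v : Coord 2) :
    divergence L.g L.stressBienergy x v = 4 * ∑ i, ∑ j, (gram L.g x)⁻¹ i j *
      L.h (L.F x) (L.secondFF x (bvec j) v) (L.cov L.meanCurv x (bvec i)) := by
  have hη := hL.contDiffOn_meanCurv
  have hn := fun y (hy : y ∈ U) => hL.inner_meanCurv_dF hy
  have hS : ∀ y ∈ U, ∀ u v, L.stressBienergy y u v =
      -2 * κ ^ 2 * L.g y u v + 4 * L.weingarten L.meanCurv y u v := by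
    intro y hy u v
    rw [LocalMap.stressBienergy, LocalMap.shape, hκ y hy, hL.inner_secondFF hη hn hy]
  have hdS : ∀ u v w, fderiv ℝ (fun y => L.stressBienergy y u v) x w =
      -2 * κ ^ 2 * (L.g x (christoffel L.g x w u) v + L.g x u (christoffel L.g x w v))
      + 4 * fderiv ℝ (fun y => L.weingarten L.meanCurv y u v) x w := by
    intro u v w
    have e : (fun y => L.stressBienergy y u v) =ᶠ[nhds x]
        fun y => -2 * κ ^ 2 * L.g y u v + 4 * L.weingarten L.meanCurv y u v := by
      filter_upwards [hL.isOpen.mem_nhds hx] with y hy using hS y hy u v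
    have h3 := ((hL.source.differentiableAt hx).hasFDerivAt.clm_apply
      (hasFDerivAt_const u x)).clm_apply (hasFDerivAt_const v x)
    have h4 := (hL.diff (hL.contDiffOn_weingarten hη u v) hx).hasFDerivAt
    rw [e.fderiv_eq, ((h3.const_mul (-2 * κ ^ 2)).fun_add (h4.const_mul 4)).fderiv]
    simp [hL.source.fderiv_metric hx]
  have hsum₂ : ∀ u v, ∑ k, v k * L.weingarten L.meanCurv x u (bvec k) =
      L.weingarten L.meanCurv x u v := by
    intro u v
    simp only [LocalMap.weingarten]
    conv_rhs => rw [← sum_bvec v]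
    simp
  have hsum₁ : ∀ u v, ∑ k, u k * L.weingarten L.meanCurv x (bvec k) v =
      L.weingarten L.meanCurv x u v := by
    intro u v
    simp only [hL.weingarten_symm hη hn hx _ v, hsum₂]
  have htr := hL.source.fderiv_sum_gram_inv hx
    (fun y i j => L.weingarten L.meanCurv y (bvec i) (bvec j))
    (fun i j => hL.diff (hL.contDiffOn_weingarten hη _ _) hx) v
  -- Since `trace A_H = 2|H|²` is constant, the trace of `∇_v A_H` vanishes.
  have hconst : (fun y => ∑ i, ∑ j, (gram L.g y)⁻¹ i j *
      L.weingarten L.meanCurv y (bvec i) (bvec j)) =ᶠ[nhds x] fun _ => 2 * κ ^ 2 := by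
    filter_upwards [hL.isOpen.mem_nhds hx] with y hy
    rw [hL.sum_gram_inv_weingarten_meanCurv hy, hL.inner_meanCurv_self hκ hy]
  simp only [hsum₁, hsum₂] at htr
  rw [hconst.fderiv_eq, fderiv_fun_const, Pi.zero_apply, zero_apply] at htr
  -- The other Codazzi term traces to `2⟨H, ∇_v H⟩`, which vanishes because `|H|` is constant.
  have hH := L.sum_gram_inv_inner_secondFF x two_ne_zero (L.cov L.meanCurv x v)
  rw [hL.inner_comm hx (L.meanCurv x), hL.inner_cov_meanCurv hκ hx, mul_zero] at hH
  have hΓ : ∀ i j w, L.h (L.F x) (L.cov (fun y => fderiv ℝ L.F y j) x i)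
      (L.cov L.meanCurv x w) = L.h (L.F x) (L.secondFF x i j) (L.cov L.meanCurv x w)
        - L.weingarten L.meanCurv x w (christoffel L.g x i j) := by
    intro i j w
    rw [hL.secondFF_eq hx, LocalMap.weingarten, map_sub, sub_apply]
    ring
  -- The term `-2κ² g` of `S₂` is parallel, so only `4 ∇A_H` remains; Codazzi moves the derivative
  -- into the direction `v`.
  have hterm : ∀ i j : Coord 2, fderiv ℝ (fun y => L.stressBienergy y j v) x i
      - L.stressBienergy x (christoffel L.g x i j) v
      - L.stressBienergy x j (christoffel L.g x i v) =
      4 * ((fderiv ℝ (fun y => L.weingarten L.meanCurv y i j) x v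
        - L.weingarten L.meanCurv x (christoffel L.g x v i) j
        - L.weingarten L.meanCurv x i (christoffel L.g x v j))
        - L.h (L.F x) (L.secondFF x i j) (L.cov L.meanCurv x v)
        + L.h (L.F x) (L.secondFF x j v) (L.cov L.meanCurv x i)) := by
    intro i j
    rw [hdS, hS x hx, hS x hx, hL.fderiv_weingarten hη hn hx hc, hΓ, hΓ,
      hL.source.christoffel_symm hx i v, hL.secondFF_symm hx v j,
      hL.weingarten_symm hη hn hx v, hL.weingarten_symm hη hn hx j]
    ring
  simp only [divergence, hterm]
  rw [← sub_eq_zero]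
  calc _ = 4 * (∑ i, ∑ j, (gram L.g x)⁻¹ i j *
        (fderiv ℝ (fun y => L.weingarten L.meanCurv y (bvec i) (bvec j)) x v
        - L.weingarten L.meanCurv x (christoffel L.g x v (bvec i)) (bvec j)
        - L.weingarten L.meanCurv x (bvec i) (christoffel L.g x v (bvec j))))
      - 4 * ∑ i, ∑ j, (gram L.g x)⁻¹ i j *
        L.h (L.F x) (L.secondFF x (bvec i) (bvec j)) (L.cov L.meanCurv x v) := by
        simp only [Finset.mul_sum, ← Finset.sum_sub_distrib]
        exact Finset.sum_congr rfl fun i _ => Finset.sum_congr rfl fun j _ => by ring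
    _ = 0 := by rw [← htr, hH]; simp

/-- The biconservative equation in an orthonormal basis `e` of the tangent plane. -/
lemma sum_inner_cov_meanCurv {c : ℝ}
    (hc : ∀ z ∈ W, ∀ u v, LinearIndependent ℝ ![u, v] → sectional L.h z u v = c)
    (hdiv : ∀ v, divergence L.g L.stressBienergy x v = 0) {e : Fin 2 → Coord 2}
    (he : ∀ a b, L.g x (e a) (e b) = if a = b then 1 else 0) (v : Coord 2) :
    ∑ a, L.h (L.F x) (L.secondFF x (e a) v) (L.cov L.meanCurv x (e a)) = 0 := by
  have h1 := hL.divergence_stressBienergy hκ hx hc v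
  rw [hdiv, IsMetricOn.sum_gram_inv he
    (fun i j => L.h (L.F x) (L.secondFF x j v) (L.cov L.meanCurv x i))] at h1
  · linarith
  · intro f w
    simp only [L.cov_sum, map_sum, map_smul, smul_eq_mul]
  · intro f w
    simp only [hL.secondFF_eq hx, L.cov_sum, ← christoffelCLM_apply, map_sum, map_smul, sum_apply,
      smul_apply, ← Finset.sum_sub_distrib, ← smul_sub, smul_eq_mul]

end Biconservative

end LocalMap.IsIsometricOn

/-! ## Moving frames -/

section Frame

variable {m n : ℕ}

/-- The coframe `θ_a(u) = ⟨dF(u), E_a⟩` of a frame `E` along `F`. -/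
def LocalMap.coframe (L : LocalMap m n) (E : Fin n → Coord m → Coord n) (a : Fin n)
    (x u : Coord m) : ℝ :=
  L.h (L.F x) (fderiv ℝ L.F x u) (E a x)

/-- The connection forms `ω_ab(u) = ⟨∇_u E_a, E_b⟩` of a frame `E` along `F`. -/
def LocalMap.connForm (L : LocalMap m n) (E : Fin n → Coord m → Coord n) (a b : Fin n)
    (x u : Coord m) : ℝ :=
  L.h (L.F x) (L.cov (E a) x u) (E b x)

namespace LocalMap.IsIsometricOn

variable {L : LocalMap m n} {U : Set (Coord m)} {W : Set (Coord n)}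
  (hL : L.IsIsometricOn U W) {E : Fin n → Coord m → Coord n} (hE : ∀ a, ContDiffOn ℝ ∞ (E a) U)
  (ho : ∀ x ∈ U, ∀ a b, L.h (L.F x) (E a x) (E b x) = if a = b then 1 else 0)
  {x : Coord m} (hx : x ∈ U)

include hL hE ho hx

lemma connForm_antisymm (a b : Fin n) (u : Coord m) :
    L.connForm E a b x u = -L.connForm E b a x u := by
  have h1 := hL.fderiv_inner hx (hL.diff (hE a) hx) (hL.diff (hE b) hx) u
  have h2 : (fun y => L.h (L.F y) (E a y) (E b y)) =ᶠ[nhds x]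
      fun _ => if a = b then 1 else 0 := by
    filter_upwards [hL.isOpen.mem_nhds hx] with y hy using ho y hy a b
  rw [h2.fderiv_eq, hL.inner_comm hx (E a x)] at h1
  simp only [fderiv_fun_const, Pi.zero_apply, zero_apply] at h1
  simp only [LocalMap.connForm]
  linarith

/-- The first structure equation. -/
lemma first_structure (a : Fin n) (u v : Coord m) :
    fderiv ℝ (fun y => L.coframe E a y v) x u - fderiv ℝ (fun y => L.coframe E a y u) x v =
      ∑ b, (L.coframe E b x v * L.connForm E a b x u
        - L.coframe E b x u * L.connForm E a b x v) := by
  have key : ∀ u v, fderiv ℝ (fun y => L.coframe E a y v) x u =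
      L.h (L.F x) (L.cov (fun y => fderiv ℝ L.F y v) x u) (E a x)
      + ∑ b, L.coframe E b x v * L.connForm E a b x u := fun u v => by
    rw [show (fun y => L.coframe E a y v) =
      fun y => L.h (L.F y) (fderiv ℝ L.F y v) (E a y) from rfl,
      hL.fderiv_inner hx (hL.diff (hL.contDiffOn_dF v) hx) (hL.diff (hE a) hx),
      hL.target.inner_eq_sum (hL.mapsTo hx) (ho x hx) (fderiv ℝ L.F x v)]
    rfl
  rw [key, key, hL.cov_dF_comm hx, Finset.sum_sub_distrib]
  ring

/-- The second structure equation, in a space form. -/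
lemma second_structure {c : ℝ}
    (hc : ∀ z ∈ W, ∀ u v, LinearIndependent ℝ ![u, v] → sectional L.h z u v = c)
    (a b : Fin n) (u v : Coord m) :
    fderiv ℝ (fun y => L.connForm E a b y v) x u - fderiv ℝ (fun y => L.connForm E a b y u) x v =
      c * (L.coframe E a x v * L.coframe E b x u - L.coframe E a x u * L.coframe E b x v)
      + ∑ d, (L.connForm E a d x v * L.connForm E b d x u
        - L.connForm E a d x u * L.connForm E b d x v) := by
  have key : ∀ u v, fderiv ℝ (fun y => L.connForm E a b y v) x u =
      L.h (L.F x) (L.cov (fun y => L.cov (E a) y v) x u) (E b x)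
      + ∑ d, L.connForm E a d x v * L.connForm E b d x u := fun u v => by
    rw [show (fun y => L.connForm E a b y v) =
      fun y => L.h (L.F y) (L.cov (E a) y v) (E b y) from rfl,
      hL.fderiv_inner hx (hL.diff (hL.contDiffOn_cov (hE a) v) hx) (hL.diff (hE b) hx),
      hL.target.inner_eq_sum (hL.mapsTo hx) (ho x hx) (L.cov (E a) x v)]
    rfl
  have h1 := congrArg (fun P => L.h (L.F x) P (E b x)) (hL.cov_cov (hE a) hx u v)
  simp only [map_sub, sub_apply] at h1
  rw [hL.target.inner_curvature_of_sectional (hL.mapsTo hx) (hc _ (hL.mapsTo hx))] at h1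
  rw [key, key, Finset.sum_sub_distrib]
  simp only [LocalMap.coframe]
  linarith

end LocalMap.IsIsometricOn

end Frame

/-- The structure equations of a frame `E₀, E₁` (tangent), `E₂, E₃` (normal) of a surface for which
`E₂` is not parallel, `A_{E₃} = 0` and `A_{E₂}` has nonzero trace force the space form to be flat. -/
lemma LocalMap.IsIsometricOn.eq_zero_of_frame {L : LocalMap 2 4} {U : Set (Coord 2)}
    {W : Set (Coord 4)} (hL : L.IsIsometricOn U W) {c : ℝ}
    (hc : ∀ z ∈ W, ∀ u v, LinearIndependent ℝ ![u, v] → sectional L.h z u v = c)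
    {E : Fin 4 → Coord 2 → Coord 4} (hE : ∀ a, ContDiffOn ℝ ∞ (E a) U)
    (ho : ∀ x ∈ U, ∀ a b, L.h (L.F x) (E a x) (E b x) = if a = b then 1 else 0)
    {e₀ e₁ : Coord 2 → Coord 2} (hE₀ : ∀ x ∈ U, E 0 x = fderiv ℝ L.F x (e₀ x))
    (hE₁ : ∀ x ∈ U, E 1 x = fderiv ℝ L.F x (e₁ x))
    (hspan : ∀ x ∈ U, ∀ u, u = L.coframe E 0 x u • e₀ x + L.coframe E 1 x u • e₁ x)
    (hθ₂ : ∀ x ∈ U, ∀ u, L.coframe E 2 x u = 0) (hθ₃ : ∀ x ∈ U, ∀ u, L.coframe E 3 x u = 0)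
    (hω₀ : ∀ x ∈ U, L.connForm E 2 3 x (e₀ x) ≠ 0) (hω₁ : ∀ x ∈ U, L.connForm E 2 3 x (e₁ x) = 0)
    (h30 : ∀ x ∈ U, L.connForm E 3 0 x (e₀ x) = 0) (h31 : ∀ x ∈ U, L.connForm E 3 1 x (e₀ x) = 0)
    {κ : ℝ} (hκ : κ ≠ 0)
    (htr₂ : ∀ x ∈ U, L.connForm E 2 0 x (e₀ x) + L.connForm E 2 1 x (e₁ x) = -2 * κ)
    (htr₃ : ∀ x ∈ U, L.connForm E 3 0 x (e₀ x) + L.connForm E 3 1 x (e₁ x) = 0)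
    {x₀ : Coord 2} (hx₀ : x₀ ∈ U) : c = 0 := by
  have hanti := fun {x} (hx : x ∈ U) => hL.connForm_antisymm hE ho hx
  have hself : ∀ x ∈ U, ∀ a u, L.connForm E a a x u = 0 := fun x hx a u => by
    linarith [hanti hx a a u]
  have hlin : ∀ a b, ∀ x ∈ U, ∀ u, L.connForm E a b x u =
      L.coframe E 0 x u * L.connForm E a b x (e₀ x)
      + L.coframe E 1 x u * L.connForm E a b x (e₁ x) := by
    intro a b x hx u
    conv_lhs => rw [hspan x hx u]
    simp only [LocalMap.connForm, L.cov_add_right, L.cov_smul_right, map_add, map_smul, add_apply,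
      smul_apply, smul_eq_mul]
  have θ00 : ∀ x ∈ U, L.coframe E 0 x (e₀ x) = 1 := fun x hx => by
    rw [LocalMap.coframe, ← hE₀ x hx, ho x hx]; simp
  have θ10 : ∀ x ∈ U, L.coframe E 1 x (e₀ x) = 0 := fun x hx => by
    rw [LocalMap.coframe, ← hE₀ x hx, ho x hx]; simp
  have θ01 : ∀ x ∈ U, L.coframe E 0 x (e₁ x) = 0 := fun x hx => by
    rw [LocalMap.coframe, ← hE₁ x hx, ho x hx]; simp
  have θ11 : ∀ x ∈ U, L.coframe E 1 x (e₁ x) = 1 := fun x hx => by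
    rw [LocalMap.coframe, ← hE₁ x hx, ho x hx]; simp
  have hzero : ∀ f : Coord 2 → ℝ, (∀ y ∈ U, f y = 0) → ∀ x ∈ U, ∀ u, fderiv ℝ f x u = 0 := by
    intro f hf x hx u
    have : f =ᶠ[nhds x] fun _ => 0 := Filter.eventuallyEq_of_mem (hL.isOpen.mem_nhds hx) hf
    rw [this.fderiv_eq]
    simp
  have s1 := fun a {x} (hx : x ∈ U) => hL.first_structure hE ho hx a (e₀ x) (e₁ x)
  have s2 := fun a b {x} (hx : x ∈ U) => hL.second_structure hE ho hx hc a b (e₀ x) (e₁ x)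
  -- For a normal `E a`, the equation `dθ_a = 0` is the symmetry of its shape operator.
  have sym : ∀ a, (∀ x ∈ U, ∀ u, L.coframe E a x u = 0) → ∀ x ∈ U,
      L.connForm E a 1 x (e₀ x) = L.connForm E a 0 x (e₁ x) := by
    intro a ha x hx
    have h1 := s1 a hx
    rw [hzero _ (fun y hy => ha y hy _) x hx, hzero _ (fun y hy => ha y hy _) x hx] at h1
    simp only [Fin.sum_univ_four, hθ₂ x hx, hθ₃ x hx, θ00 x hx, θ01 x hx, θ10 x hx, θ11 x hx] at h1
    linarith
  have w30 : ∀ x ∈ U, ∀ u, L.connForm E 3 0 x u = 0 := fun x hx u => by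
    rw [hlin 3 0 x hx, h30 x hx, ← sym 3 hθ₃ x hx, h31 x hx]; ring
  have w31 : ∀ x ∈ U, ∀ u, L.connForm E 3 1 x u = 0 := fun x hx u => by
    have := htr₃ x hx
    rw [h30 x hx] at this
    rw [hlin 3 1 x hx, h31 x hx]
    linear_combination L.coframe E 1 x u * this
  have w03 : ∀ x ∈ U, ∀ u, L.connForm E 0 3 x u = 0 := fun x hx u => by
    rw [hanti hx, w30 x hx, neg_zero]
  have w13 : ∀ x ∈ U, ∀ u, L.connForm E 1 3 x u = 0 := fun x hx u => by
    rw [hanti hx, w31 x hx, neg_zero]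
  -- As `ω₃₀` and `ω₃₁` vanish, `dω₃₀ = 0` reduces to `ω₂₃ ∧ ω₀₂ = 0`; evaluation on `(e₀, e₁)` uses
  -- `ω₂₃(e₁) = 0` and `ω₂₃(e₀) ≠ 0`.
  have w02₁ : ∀ x ∈ U, L.connForm E 0 2 x (e₁ x) = 0 := fun x hx => by
    have h1 := s2 3 0 hx
    rw [hzero _ (fun y hy => w30 y hy _) x hx, hzero _ (fun y hy => w30 y hy _) x hx] at h1
    simp only [Fin.sum_univ_four, hθ₃ x hx, w30 x hx, w31 x hx, hself x hx, hanti hx 3 2,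
      hω₁ x hx] at h1
    have h2 : L.connForm E 2 3 x (e₀ x) * L.connForm E 0 2 x (e₁ x) = 0 := by linarith
    exact (mul_eq_zero.1 h2).resolve_left (hω₀ x hx)
  have w12₁ : ∀ x ∈ U, L.connForm E 1 2 x (e₁ x) = 0 := fun x hx => by
    have h1 := s2 3 1 hx
    rw [hzero _ (fun y hy => w31 y hy _) x hx, hzero _ (fun y hy => w31 y hy _) x hx] at h1
    simp only [Fin.sum_univ_four, hθ₃ x hx, w30 x hx, w31 x hx, hself x hx, hanti hx 3 2,
      hω₁ x hx] at h1
    have h2 : L.connForm E 2 3 x (e₀ x) * L.connForm E 1 2 x (e₁ x) = 0 := by linarith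
    exact (mul_eq_zero.1 h2).resolve_left (hω₀ x hx)
  have w20₁ : ∀ x ∈ U, L.connForm E 2 0 x (e₁ x) = 0 := fun x hx => by
    rw [hanti hx, w02₁ x hx, neg_zero]
  have w21₁ : ∀ x ∈ U, L.connForm E 2 1 x (e₁ x) = 0 := fun x hx => by
    rw [hanti hx, w12₁ x hx, neg_zero]
  have w21 : ∀ x ∈ U, ∀ u, L.connForm E 2 1 x u = 0 := fun x hx u => by
    rw [hlin 2 1 x hx, w21₁ x hx, sym 2 hθ₂ x hx, w20₁ x hx]; ring
  have w12 : ∀ x ∈ U, ∀ u, L.connForm E 1 2 x u = 0 := fun x hx u => by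
    rw [hanti hx, w21 x hx, neg_zero]
  have w20 : ∀ x ∈ U, ∀ u, L.connForm E 2 0 x u = -2 * κ * L.coframe E 0 x u := fun x hx u => by
    have := htr₂ x hx
    rw [w21 x hx, add_zero] at this
    rw [hlin 2 0 x hx, w20₁ x hx, this]; ring
  -- With `ω₂₁ = 0` and `ω₂₀ = -2κ θ₀`, the equation for `dω₂₁` leaves only `2κ ω₁₀(e₁) = 0`.
  have w10₁ : ∀ x ∈ U, L.connForm E 1 0 x (e₁ x) = 0 := fun x hx => by
    have h1 := s2 2 1 hx
    rw [hzero _ (fun y hy => w21 y hy _) x hx, hzero _ (fun y hy => w21 y hy _) x hx] at h1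
    simp only [Fin.sum_univ_four, hθ₂ x hx, w20 x hx, w21 x hx, w13 x hx, hself x hx, θ00 x hx,
      θ01 x hx] at h1
    have h2 : κ * L.connForm E 1 0 x (e₁ x) = 0 := by linarith
    exact (mul_eq_zero.1 h2).resolve_left hκ
  -- The second structure equation gives `dω₂₀ = 0`, while `dω₂₀ = -2κ dθ₀` and `dθ₀(e₀, e₁) =
  -- ω₀₁(e₀)`.
  have w01₀ : ∀ x ∈ U, L.connForm E 0 1 x (e₀ x) = 0 := fun x hx => by
    have h1 := s2 2 0 hx
    have h2 := s1 0 hx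
    have hd : ∀ u v, fderiv ℝ (fun y => L.connForm E 2 0 y v) x u =
        -2 * κ * fderiv ℝ (fun y => L.coframe E 0 y v) x u := fun u v => by
      have e : (fun y => L.connForm E 2 0 y v) =ᶠ[nhds x] fun y => -2 * κ * L.coframe E 0 y v := by
        filter_upwards [hL.isOpen.mem_nhds hx] with y hy using w20 y hy v
      have hdiff : DifferentiableAt ℝ (fun y => L.coframe E 0 y v) x :=
        hL.diff (hL.contDiffOn_inner (hL.contDiffOn_dF v) (hE 0)) hx
      rw [e.fderiv_eq, fderiv_const_mul hdiff, smul_apply, smul_eq_mul]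
    rw [hd, hd, ← mul_sub, h2] at h1
    simp only [Fin.sum_univ_four, hθ₂ x hx, hθ₃ x hx, w21 x hx, w03 x hx, hself x hx, θ00 x hx,
      θ01 x hx, θ10 x hx, θ11 x hx] at h1
    have h2 : κ * L.connForm E 0 1 x (e₀ x) = 0 := by linarith
    exact (mul_eq_zero.1 h2).resolve_left hκ
  have w01 : ∀ x ∈ U, ∀ u, L.connForm E 0 1 x u = 0 := fun x hx u => by
    rw [hlin 0 1 x hx, w01₀ x hx, hanti hx 0 1 (e₁ x), w10₁ x hx]; ring
  -- The Gauss equation: `dω₀₁ = 0`, and every connection product vanishes, leaving `0 = -c`.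
  have h1 := s2 0 1 hx₀
  rw [hzero _ (fun y hy => w01 y hy _) x₀ hx₀, hzero _ (fun y hy => w01 y hy _) x₀ hx₀] at h1
  simp only [Fin.sum_univ_four, w01 x₀ hx₀, w12 x₀ hx₀, w13 x₀ hx₀, hself x₀ hx₀, θ00 x₀ hx₀,
    θ01 x₀ hx₀, θ10 x₀ hx₀, θ11 x₀ hx₀] at h1
  linarith

/-! ### The adapted frame and the local theorem. -/

lemma LocalMap.weingarten_sum_left {m n : ℕ} (L : LocalMap m n) (η : Coord m → Coord n)
    (x v : Coord m) {ι : Type*} (s : Finset ι) (f : ι → ℝ) (w : ι → Coord m) :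
    L.weingarten η x (∑ i ∈ s, f i • w i) v = ∑ i ∈ s, f i * L.weingarten η x (w i) v := by
  simp [LocalMap.weingarten, L.cov_sum]

lemma LocalMap.weingarten_sum_right {m n : ℕ} (L : LocalMap m n) (η : Coord m → Coord n)
    (x u : Coord m) {ι : Type*} (s : Finset ι) (f : ι → ℝ) (w : ι → Coord m) :
    L.weingarten η x u (∑ i ∈ s, f i • w i) = ∑ i ∈ s, f i * L.weingarten η x u (w i) := by
  simp [LocalMap.weingarten]

/-- The trace of the shape operator `A_η` in an orthonormal basis. -/
lemma LocalMap.IsIsometricOn.sum_weingarten {m n : ℕ} {L : LocalMap m n} {U : Set (Coord m)}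
    {W : Set (Coord n)} (hL : L.IsIsometricOn U W) (hm : m ≠ 0) {η : Coord m → Coord n}
    (hη : ContDiffOn ℝ ∞ η U) (hn : ∀ y ∈ U, ∀ v, L.h (L.F y) (η y) (fderiv ℝ L.F y v) = 0)
    {x : Coord m} (hx : x ∈ U) {e : Fin m → Coord m}
    (he : ∀ a b, L.g x (e a) (e b) = if a = b then 1 else 0) :
    ∑ a, L.weingarten η x (e a) (e a) = m * L.h (L.F x) (L.meanCurv x) (η x) := by
  rw [← L.sum_gram_inv_inner_secondFF x hm]
  simp only [hL.inner_secondFF hη hn hx]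
  rw [IsMetricOn.sum_gram_inv he]
  · intro f v; exact L.weingarten_sum_left η x v _ f _
  · intro f u; exact L.weingarten_sum_right η x u _ f _

lemma contDiffOn_inv_sqrt {E : Type*} [NormedAddCommGroup E] [NormedSpace ℝ E] {q : E → ℝ}
    {U : Set E} (hq : ContDiffOn ℝ ∞ q U) (hpos : ∀ x ∈ U, 0 < q x) :
    ContDiffOn ℝ ∞ (fun x => (√(q x))⁻¹) U :=
  (hq.sqrt fun x hx => (hpos x hx).ne').inv fun x hx => (Real.sqrt_pos.2 (hpos x hx)).ne'

lemma inv_sqrt_mul_self {a : ℝ} (ha : 0 < a) : (√a)⁻¹ * ((√a)⁻¹ * a) = 1 := by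
  have h1 := Real.sqrt_pos.2 ha
  rw [← mul_assoc, ← mul_inv, Real.mul_self_sqrt ha.le, inv_mul_cancel₀ ha.ne']

/-- A biconservative surface with `|H|` constant in a four-dimensional space form which is not flat
has parallel mean curvature vector: the local statement. -/
theorem LocalMap.IsIsometricOn.normalCovMeanCurv_eq_zero {L : LocalMap 2 4} {U : Set (Coord 2)}
    {W : Set (Coord 4)} (hL : L.IsIsometricOn U W) {c : ℝ} (hc0 : c ≠ 0)
    (hc : ∀ z ∈ W, ∀ u v, LinearIndependent ℝ ![u, v] → sectional L.h z u v = c)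
    (hdiv : ∀ x ∈ U, ∀ v, divergence L.g L.stressBienergy x v = 0)
    {κ : ℝ} (hκ : ∀ x ∈ U, L.normMeanCurv x = κ) {x₀ : Coord 2} (hx₀ : x₀ ∈ U) (u₀ : Coord 2) :
    L.normalCovMeanCurv x₀ u₀ = 0 := by
  by_contra hne
  -- If `κ = 0`, then `H` vanishes identically and so does its normal derivative.
  have hκ0 : κ ≠ 0 := by
    intro h0
    apply hne
    have hH : Set.EqOn L.meanCurv (fun _ => 0) U := fun y hy =>
      hL.target.eq_zero_of_self (hL.mapsTo hy) (by rw [hL.inner_meanCurv_self hκ hy, h0]; simp)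
    rw [LocalMap.normalCovMeanCurv, L.cov_congr hL.isOpen hH hx₀]
    simp [LocalMap.cov, LocalMap.normalPart, ← christoffelCLM_apply]
  have hNs : ContDiffOn ℝ ∞ (fun y => L.normalCovMeanCurv y u₀) U :=
    hL.contDiffOn_normalPart (hL.contDiffOn_cov hL.contDiffOn_meanCurv u₀)
  obtain ⟨V, hVo, hVU, hx₀V, hNV⟩ : ∃ V, IsOpen V ∧ V ⊆ U ∧ x₀ ∈ V ∧
      ∀ y ∈ V, L.normalCovMeanCurv y u₀ ≠ 0 :=
    ⟨_, hNs.continuousOn.isOpen_inter_preimage hL.isOpen isOpen_compl_singleton,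
      Set.inter_subset_left, ⟨hx₀, hne⟩, fun y hy => hy.2⟩
  replace hL := hL.mono hVo hVU
  replace hκ : ∀ x ∈ V, L.normMeanCurv x = κ := fun x hx => hκ x (hVU hx)
  replace hdiv : ∀ x ∈ V, ∀ v, divergence L.g L.stressBienergy x v = 0 :=
    fun x hx => hdiv x (hVU hx)
  set N : Coord 2 → Coord 4 := fun y => L.normalCovMeanCurv y u₀ with hN
  replace hNs : ContDiffOn ℝ ∞ N V := hNs.mono hVU
  have hHs := hL.contDiffOn_meanCurv
  have hHn := fun y (hy : y ∈ V) => hL.inner_meanCurv_dF hy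
  have hNn : ∀ y ∈ V, ∀ v, L.h (L.F y) (N y) (fderiv ℝ L.F y v) = 0 :=
    fun y hy v => hL.inner_normalPart_dF hy _ v
  have hNH : ∀ y ∈ V, L.h (L.F y) (N y) (L.meanCurv y) = 0 := fun y hy => by
    rw [hN]
    simp only [LocalMap.normalCovMeanCurv]
    rw [hL.inner_normalPart hy _ (hHn y hy), hL.inner_cov_meanCurv hκ hy]
  have hNN : ∀ y ∈ V, 0 < L.h (L.F y) (N y) (N y) :=
    fun y hy => hL.target.pos _ (hL.mapsTo hy) _ (hNV y hy)
  -- the direction `e₁` in the kernel of `⟨∇^⊥ H, N⟩`, and its complement `e₀`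
  let τ : Coord 2 → Coord 2 → ℝ := fun y u => L.h (L.F y) (L.cov L.meanCurv y u) (N y)
  have hτs : ∀ u, ContDiffOn ℝ ∞ (fun y => τ y u) V :=
    fun u => hL.contDiffOn_inner (hL.contDiffOn_cov hHs u) hNs
  have hτ_add : ∀ y u v, τ y (u + v) = τ y u + τ y v := fun y u v => by
    simp only [τ, L.cov_add_right, map_add, add_apply]
  have hτ_smul : ∀ y (a : ℝ) u, τ y (a • u) = a * τ y u := fun y a u => by
    simp only [τ, L.cov_smul_right, map_smul, smul_apply, smul_eq_mul]
  have hτ₀ : ∀ y ∈ V, τ y u₀ ≠ 0 := fun y hy => by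
    have : τ y u₀ = L.h (L.F y) (N y) (N y) :=
      (hL.inner_normalPart hy (L.cov L.meanCurv y u₀) (hNn y hy)).symm
    rw [this]
    exact (hNN y hy).ne'
  -- The coefficients of `τ` turned by a right angle: a smooth field in `ker τ`, nonvanishing
  -- because `τ` is.
  let w : Coord 2 → Coord 2 := fun y => τ y (bvec 0) • bvec 1 + (-τ y (bvec 1)) • bvec 0
  have hws : ContDiffOn ℝ ∞ w V :=
    ((hτs _).smul contDiffOn_const).add ((hτs _).neg.smul contDiffOn_const)
  have hτw : ∀ y, τ y (w y) = 0 := fun y => by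
    simp only [w, hτ_add, hτ_smul]; ring
  have hw : ∀ y ∈ V, w y ≠ 0 := fun y hy h0 => by
    apply hτ₀ y hy
    have h1 : τ y (bvec 0) = 0 := by
      simpa [w, bvec] using congrArg (fun u : Coord 2 => u 1) h0
    have h2 : τ y (bvec 1) = 0 := by
      simpa [w, bvec] using congrArg (fun u : Coord 2 => u 0) h0
    rw [← sum_bvec u₀, Fin.sum_univ_two, hτ_add, hτ_smul, hτ_smul, h1, h2]
    ring
  have hgs : ∀ {a b : Coord 2 → Coord 2}, ContDiffOn ℝ ∞ a V → ContDiffOn ℝ ∞ b V →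
      ContDiffOn ℝ ∞ (fun y => L.g y (a y) (b y)) V := fun ha hb =>
    (hL.source.smooth.clm_apply ha).clm_apply hb
  have hgw : ∀ y ∈ V, 0 < L.g y (w y) (w y) := fun y hy => hL.source.pos y hy _ (hw y hy)
  let e₁ : Coord 2 → Coord 2 := fun y => (√(L.g y (w y) (w y)))⁻¹ • w y
  have he₁s : ContDiffOn ℝ ∞ e₁ V := (contDiffOn_inv_sqrt (hgs hws hws) hgw).smul hws
  have he₁₁ : ∀ y ∈ V, L.g y (e₁ y) (e₁ y) = 1 := fun y hy => by
    simp only [e₁, map_smul, smul_apply, smul_eq_mul]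
    exact inv_sqrt_mul_self (hgw y hy)
  have hτe₁ : ∀ y, τ y (e₁ y) = 0 := fun y => by
    simp only [e₁, hτ_smul, hτw, mul_zero]
  -- Gram–Schmidt on `u₀`. Subtracting a multiple of `e₁` keeps the value of `τ`, so `z` cannot
  -- vanish.
  let z : Coord 2 → Coord 2 := fun y => u₀ + (-L.g y u₀ (e₁ y)) • e₁ y
  have hzs : ContDiffOn ℝ ∞ z V :=
    contDiffOn_const.add ((hgs contDiffOn_const he₁s).neg.smul he₁s)
  have hτz : ∀ y, τ y (z y) = τ y u₀ := fun y => by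
    simp only [z, hτ_add, hτ_smul, hτe₁]; ring
  have hz : ∀ y ∈ V, z y ≠ 0 := fun y hy h0 => by
    apply hτ₀ y hy
    have h1 := hτ_smul y 0 0
    rw [← hτz, h0]
    simpa using h1
  have hgz : ∀ y ∈ V, 0 < L.g y (z y) (z y) := fun y hy => hL.source.pos y hy _ (hz y hy)
  have hze₁ : ∀ y ∈ V, L.g y (z y) (e₁ y) = 0 := fun y hy => by
    simp only [z, map_add, add_apply, map_smul, smul_apply, smul_eq_mul, he₁₁ y hy]
    ring
  let e₀ : Coord 2 → Coord 2 := fun y => (√(L.g y (z y) (z y)))⁻¹ • z y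
  have he₀s : ContDiffOn ℝ ∞ e₀ V := (contDiffOn_inv_sqrt (hgs hzs hzs) hgz).smul hzs
  have he₀₀ : ∀ y ∈ V, L.g y (e₀ y) (e₀ y) = 1 := fun y hy => by
    simp only [e₀, map_smul, smul_apply, smul_eq_mul]
    exact inv_sqrt_mul_self (hgz y hy)
  have he₀₁ : ∀ y ∈ V, L.g y (e₀ y) (e₁ y) = 0 := fun y hy => by
    simp only [e₀, map_smul, smul_apply, smul_eq_mul, hze₁ y hy, mul_zero]
  have hτe₀ : ∀ y ∈ V, τ y (e₀ y) ≠ 0 := fun y hy => by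
    simp only [e₀, hτ_smul, hτz]
    exact mul_ne_zero (inv_ne_zero (Real.sqrt_pos.2 (hgz y hy)).ne') (hτ₀ y hy)
  have he : ∀ y ∈ V, ∀ a b, L.g y ((![e₀ y, e₁ y] : Fin 2 → Coord 2) a)
      ((![e₀ y, e₁ y] : Fin 2 → Coord 2) b) = if a = b then 1 else 0 := by
    intro y hy a b
    fin_cases a <;> fin_cases b <;>
      simp [he₀₀ y hy, he₁₁ y hy, he₀₁ y hy, hL.source.symm y hy (e₁ y) (e₀ y)]
  -- the frame
  let s : Coord 2 → ℝ := fun y => (√(L.h (L.F y) (N y) (N y)))⁻¹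
  have hs0 : ∀ y ∈ V, s y ≠ 0 := fun y hy => inv_ne_zero (Real.sqrt_pos.2 (hNN y hy)).ne'
  let E : Fin 4 → Coord 2 → Coord 4 := ![fun y => fderiv ℝ L.F y (e₀ y),
    fun y => fderiv ℝ L.F y (e₁ y), fun y => κ⁻¹ • L.meanCurv y, fun y => s y • N y]
  have hE₀ : ∀ y, E 0 y = fderiv ℝ L.F y (e₀ y) := fun _ => rfl
  have hE₁ : ∀ y, E 1 y = fderiv ℝ L.F y (e₁ y) := fun _ => rfl
  have hE₂ : ∀ y, E 2 y = κ⁻¹ • L.meanCurv y := fun _ => rfl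
  have hE₃ : ∀ y, E 3 y = s y • N y := fun _ => rfl
  have hE : ∀ a, ContDiffOn ℝ ∞ (E a) V := by
    intro a
    fin_cases a
    · exact hL.contDiffOn_dF_field he₀s
    · exact hL.contDiffOn_dF_field he₁s
    · exact hHs.const_smul κ⁻¹
    · exact (contDiffOn_inv_sqrt (hL.contDiffOn_inner hNs hNs) hNN).smul hNs
  have hn₂ : ∀ y ∈ V, ∀ v, L.h (L.F y) (E 2 y) (fderiv ℝ L.F y v) = 0 := fun y hy v => by
    rw [hE₂, map_smul, smul_apply, hHn y hy, smul_zero]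
  have hn₃ : ∀ y ∈ V, ∀ v, L.h (L.F y) (E 3 y) (fderiv ℝ L.F y v) = 0 := fun y hy v => by
    rw [hE₃, map_smul, smul_apply, hNn y hy, smul_zero]
  have o22 : ∀ y ∈ V, L.h (L.F y) (E 2 y) (E 2 y) = 1 := fun y hy => by
    simp only [hE₂, map_smul, smul_apply, hL.inner_meanCurv_self hκ hy, smul_eq_mul]
    field_simp
  have o32 : ∀ y ∈ V, L.h (L.F y) (E 3 y) (E 2 y) = 0 := fun y hy => by
    simp only [hE₂, hE₃, map_smul, smul_apply, hNH y hy, smul_eq_mul, mul_zero]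
  have o33 : ∀ y ∈ V, L.h (L.F y) (E 3 y) (E 3 y) = 1 := fun y hy => by
    simp only [hE₃, map_smul, smul_apply, smul_eq_mul]
    exact inv_sqrt_mul_self (hNN y hy)
  have ho : ∀ x ∈ V, ∀ a b, L.h (L.F x) (E a x) (E b x) = if a = b then 1 else 0 := by
    intro x hx
    -- The larger index comes first, so that in a mixed product the normal vector stands on the
    -- left.
    have key : ∀ a b, a ≤ b → L.h (L.F x) (E b x) (E a x) = if a = b then 1 else 0 := by
      intro a b hab
      fin_cases a <;> fin_cases b <;> first
        | exact absurd hab (by decide)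
        | simp [hE₀, hE₁, ← hL.isometry x hx, he₀₀ x hx, he₁₁ x hx, he₀₁ x hx,
            hL.source.symm x hx (e₁ x) (e₀ x), hn₂ x hx, hn₃ x hx, o22 x hx, o32 x hx, o33 x hx]
    intro a b
    rcases le_total a b with hab | hab
    · rw [hL.inner_comm hx, key a b hab]
    · rw [key b a hab]; simp only [eq_comm]
  have hτ23 : ∀ y ∈ V, ∀ u, L.connForm E 2 3 y u = κ⁻¹ * (s y * τ y u) := fun y hy u => by
    have : L.cov (E 2) y u = κ⁻¹ • L.cov L.meanCurv y u := L.cov_const_smul κ⁻¹ L.meanCurv y u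
    simp only [LocalMap.connForm, this, hE₃, map_smul, smul_apply, smul_eq_mul, τ]
    ring
  have hbi : ∀ y ∈ V, ∀ v, L.weingarten (E 3) y (e₀ y) v = 0 := by
    intro y hy v
    have h1 := hL.sum_inner_cov_meanCurv hκ hy hc (hdiv y hy) (he y hy) v
    -- Only the `E 3` component survives: `B` is normal, which removes `E 0` and `E 1`, and `∇H ⟂ H`
    -- removes `E 2`.
    have hII : ∀ u, L.h (L.F y) (L.secondFF y u v) (L.cov L.meanCurv y u) =
        L.weingarten (E 3) y u v * (s y * τ y u) := by
      intro u
      rw [hL.target.inner_eq_sum (hL.mapsTo hy) (ho y hy), Fin.sum_univ_four,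
        hL.inner_secondFF (hE 3) hn₃ hy, hE₀, hE₁, hE₂, hE₃, LocalMap.secondFF,
        hL.inner_normalPart_dF hy, hL.inner_normalPart_dF hy, map_smul (L.h (L.F y) (L.cov _ _ _)),
        map_smul (L.h (L.F y) (L.cov _ _ _)), hL.inner_cov_meanCurv hκ hy]
      simp [τ]
    -- Because `τ(e₁) = 0`, the trace consists of its `e₀` term alone, where `τ(e₀) ≠ 0` can be
    -- divided out.
    simp only [hII, Fin.sum_univ_two, Matrix.cons_val_zero, Matrix.cons_val_one, hτe₁, mul_zero,
      add_zero] at h1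
    exact (mul_eq_zero.1 h1).resolve_right (mul_ne_zero (hs0 y hy) (hτe₀ y hy))
  have hw0 : ∀ a, ∀ y ∈ V, ∀ u, L.connForm E a 0 y u = -L.weingarten (E a) y u (e₀ y) := by
    intro a y hy u
    rw [LocalMap.connForm, LocalMap.weingarten, hE₀, hL.inner_comm hy, neg_neg]
  have hw1 : ∀ a, ∀ y ∈ V, ∀ u, L.connForm E a 1 y u = -L.weingarten (E a) y u (e₁ y) := by
    intro a y hy u
    rw [LocalMap.connForm, LocalMap.weingarten, hE₁, hL.inner_comm hy, neg_neg]
  refine hc0 (hL.eq_zero_of_frame hc hE ho (fun y _ => hE₀ y) (fun y _ => hE₁ y) ?_ ?_ ?_ ?_ ?_ ?_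
    ?_ hκ0 ?_ ?_ hx₀V)
  · intro y hy u
    have h1 := hL.source.sum_inner_smul hy (he y hy) u
    simp only [Fin.sum_univ_two, Matrix.cons_val_zero, Matrix.cons_val_one,
      hL.isometry y hy] at h1
    exact h1.symm
  · intro y hy u
    rw [LocalMap.coframe, hL.inner_comm hy, hn₂ y hy]
  · intro y hy u
    rw [LocalMap.coframe, hL.inner_comm hy, hn₃ y hy]
  · intro y hy
    rw [hτ23 y hy]
    exact mul_ne_zero (inv_ne_zero hκ0) (mul_ne_zero (hs0 y hy) (hτe₀ y hy))
  · intro y hy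
    rw [hτ23 y hy, hτe₁, mul_zero, mul_zero]
  · intro y hy
    rw [hw0 3 y hy, hbi y hy, neg_zero]
  · intro y hy
    rw [hw1 3 y hy, hbi y hy, neg_zero]
  · intro y hy
    have h1 := hL.sum_weingarten two_ne_zero (hE 2) hn₂ hy (he y hy)
    simp only [Fin.sum_univ_two, Matrix.cons_val_zero, Matrix.cons_val_one] at h1
    rw [hE₂, map_smul, hL.inner_meanCurv_self hκ hy] at h1
    rw [hw0 2 y hy, hw1 2 y hy, ← neg_add, h1]
    simp only [smul_eq_mul]
    field_simp
    norm_num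
  · intro y hy
    have h1 := hL.sum_weingarten two_ne_zero (hE 3) hn₃ hy (he y hy)
    simp only [Fin.sum_univ_two, Matrix.cons_val_zero, Matrix.cons_val_one] at h1
    rw [hE₃, map_smul, hL.inner_comm hy, hNH y hy] at h1
    rw [hw0 3 y hy, hw1 3 y hy, ← neg_add, h1]
    simp

/-! ## From manifolds to charts -/

section Charts

variable {n : ℕ} {N : Type*} [TopologicalSpace N] [ChartedSpace (Coord n) N]
  [IsManifold (𝓡 n) ∞ N]

omit [IsManifold (𝓡 n) ∞ N] in
lemma mdifferentiable_of_mem_maximalAtlas {e : OpenPartialHomeomorph N (Coord n)}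
    (he : e ∈ IsManifold.maximalAtlas (𝓡 n) ∞ N) : e.MDifferentiable (𝓡 n) (𝓡 n) :=
  ⟨(contMDiffOn_of_mem_maximalAtlas he).mdifferentiableOn (by simp),
    (contMDiffOn_symm_of_mem_maximalAtlas he).mdifferentiableOn (by simp)⟩

/-- Coordinate fields are smooth sections, being the tangent map of `e.symm` applied to a constant
section. -/
lemma contMDiffOn_mfderiv_symm {e : OpenPartialHomeomorph N (Coord n)}
    (he : e ∈ IsManifold.maximalAtlas (𝓡 n) ∞ N) (v : Coord n) :
    ContMDiffOn (𝓡 n) (𝓡 n).tangent ∞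
      (fun y : Coord n => (⟨e.symm y, mfderiv (𝓡 n) (𝓡 n) e.symm y v⟩ : TangentBundle (𝓡 n) N))
      e.target := by
  have : IsManifold (𝓡 n) 1 N := IsManifold.of_le (n := ∞) (by norm_num)
  have h1 := (contMDiffOn_symm_of_mem_maximalAtlas he).contMDiffOn_tangentMapWithin (m := ∞)
    (by norm_num) e.open_target.uniqueMDiffOn
  have h2 : ContMDiffOn (𝓡 n) (𝓡 n).tangent ∞
      (fun y : Coord n => (⟨y, v⟩ : TangentBundle (𝓡 n) (Coord n))) e.target :=
    contMDiffOn_vectorSpace_iff_contDiffOn.2 contDiffOn_const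
  refine (h1.comp h2 fun y hy => hy).congr fun y hy => ?_
  simp only [tangentMapWithin, Function.comp, mfderivWithin_of_isOpen e.open_target hy]

lemma isMetricOn_metricInChart (h : Metric n N) {e : OpenPartialHomeomorph N (Coord n)}
    (he : e ∈ IsManifold.maximalAtlas (𝓡 n) ∞ N) : IsMetricOn (metricInChart h e) e.target where
  isOpen := e.open_target
  smooth := by
    refine contDiffOn_clm_apply.2 fun u => contDiffOn_clm_apply.2 fun v => ?_
    rw [← contMDiffOn_iff_contDiffOn]
    intro y hy
    have : ContMDiffWithinAt (𝓡 n) ((𝓡 n).prod 𝓘(ℝ)) ∞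
        (fun y => Bundle.TotalSpace.mk' ℝ (E := Bundle.Trivial N ℝ) (e.symm y)
          (h.inner (e.symm y) (mfderiv (𝓡 n) (𝓡 n) e.symm y u)
            (mfderiv (𝓡 n) (𝓡 n) e.symm y v))) e.target y := by
      apply ContMDiffWithinAt.clm_bundle_apply₂ (F₁ := Coord n) (F₂ := Coord n)
      · exact h.contMDiff.contMDiffAt.comp_contMDiffWithinAt y
          (contMDiffOn_symm_of_mem_maximalAtlas he y hy)
      · exact contMDiffOn_mfderiv_symm he u y hy
      · exact contMDiffOn_mfderiv_symm he v y hy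
    simp only [Bundle.contMDiffWithinAt_totalSpace] at this
    exact this.2
  symm := fun z _ u v => h.symm _ _ _
  pos := fun z hz u hu => by
    have h1 := (mdifferentiable_of_mem_maximalAtlas he).symm.mfderiv_injective hz
    change 0 < h.inner (e.symm z) (mfderiv (𝓡 n) (𝓡 n) e.symm z u)
      (mfderiv (𝓡 n) (𝓡 n) e.symm z u)
    apply h.pos
    intro h0
    apply hu
    apply h1
    rw [h0]
    exact (map_zero (mfderiv (𝓡 n) (𝓡 n) e.symm z)).symm

/-- The value of a Riemannian metric on vectors of the model space. -/
def modelInner (h : Metric n N) (p : N) (a b : Coord n) : ℝ :=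
  h.inner p (a : TangentSpace (𝓡 n) p) (b : TangentSpace (𝓡 n) p)

lemma metricInChart_apply (h : Metric n N) (e : OpenPartialHomeomorph N (Coord n))
    (y u v : Coord n) : metricInChart h e y u v =
      modelInner h (e.symm y) (mfderiv (𝓡 n) (𝓡 n) e.symm y u) (mfderiv (𝓡 n) (𝓡 n) e.symm y v) :=
  rfl

end Charts

/-! ### Isometric immersions read in charts. -/

section Immersion

variable {m n : ℕ}
  {M : Type*} [TopologicalSpace M] [ChartedSpace (Coord m) M] [IsManifold (𝓡 m) ∞ M]
  {N : Type*} [TopologicalSpace N] [ChartedSpace (Coord n) N] [IsManifold (𝓡 n) ∞ N]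

/-- The open set on which the expression of `φ` in the charts `e`, `e'` is defined. -/
def chartDomain (φ : M → N) (e : OpenPartialHomeomorph M (Coord m))
    (e' : OpenPartialHomeomorph N (Coord n)) : Set (Coord m) :=
  e.target ∩ e.symm ⁻¹' (φ ⁻¹' e'.source)

lemma isIsometricOn_inCharts {g : Metric m M} {h : Metric n N} {φ : M → N}
    (hφ : IsIsometricImmersion g h φ) {e : OpenPartialHomeomorph M (Coord m)}
    (he : e ∈ IsManifold.maximalAtlas (𝓡 m) ∞ M) {e' : OpenPartialHomeomorph N (Coord n)}
    (he' : e' ∈ IsManifold.maximalAtlas (𝓡 n) ∞ N) :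
    (inCharts g h φ e e').IsIsometricOn (chartDomain φ e e') e'.target := by
  have hopen : IsOpen (chartDomain φ e e') :=
    e.symm.isOpen_inter_preimage (e'.open_source.preimage hφ.1.continuous)
  have hg := isMetricOn_metricInChart g he
  have hsymm := contMDiffOn_symm_of_mem_maximalAtlas he
  have hs : ContMDiffOn (𝓡 m) (𝓡 n) ∞ (fun y => e' (φ (e.symm y))) (chartDomain φ e e') :=
    (contMDiffOn_of_mem_maximalAtlas he').comp
      (hφ.1.comp_contMDiffOn (hsymm.mono Set.inter_subset_left)) fun y hy => hy.2
  refine ⟨⟨hopen, hg.smooth.mono Set.inter_subset_left, fun z hz => hg.symm z hz.1,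
    fun z hz => hg.pos z hz.1⟩, isMetricOn_metricInChart h he', hs.contDiffOn,
    fun y hy => e'.map_source hy.2, ?_⟩
  intro x hx u v
  -- Chain rule for `e'.symm ∘ F = φ ∘ e.symm`, valid near `x`; it transports `φ^* h = g` to the
  -- coordinate metrics.
  have key : ∀ u, (mfderiv (𝓡 n) (𝓡 n) e'.symm (e' (φ (e.symm x))))
      (fderiv ℝ (fun y => e' (φ (e.symm y))) x u) =
      mfderiv (𝓡 m) (𝓡 n) φ (e.symm x) (mfderiv (𝓡 m) (𝓡 m) e.symm x u) := by
    intro u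
    have d1 : MDifferentiableAt (𝓡 m) (𝓡 n) (fun y => e' (φ (e.symm y))) x :=
      (hs.contMDiffAt (hopen.mem_nhds hx)).mdifferentiableAt (by simp)
    have d2 : MDifferentiableAt (𝓡 n) (𝓡 n) e'.symm (e' (φ (e.symm x))) :=
      (mdifferentiable_of_mem_maximalAtlas he').mdifferentiableAt_symm (e'.map_source hx.2)
    have d3 : MDifferentiableAt (𝓡 m) (𝓡 m) e.symm x :=
      (mdifferentiable_of_mem_maximalAtlas he).mdifferentiableAt_symm hx.1
    have d4 : MDifferentiableAt (𝓡 m) (𝓡 n) φ (e.symm x) :=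
      hφ.1.contMDiffAt.mdifferentiableAt (by simp)
    have c1 := mfderiv_comp x d2 d1
    have c2 := mfderiv_comp x d4 d3
    have c3 : mfderiv (𝓡 m) (𝓡 n) (e'.symm ∘ fun y => e' (φ (e.symm y))) x =
        mfderiv (𝓡 m) (𝓡 n) (φ ∘ e.symm) x := by
      apply Filter.EventuallyEq.mfderiv_eq
      filter_upwards [hopen.mem_nhds hx] with y hy
      exact e'.left_inv hy.2
    rw [c1, c2, mfderiv_eq_fderiv] at c3
    exact congrArg (fun T : Coord m →L[ℝ] Coord n => T u) c3
  have h1 := hφ.2 (e.symm x) (mfderiv (𝓡 m) (𝓡 m) e.symm x u) (mfderiv (𝓡 m) (𝓡 m) e.symm x v)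
  change metricInChart g e x u v = metricInChart h e' (e' (φ (e.symm x)))
    (fderiv ℝ (fun y => e' (φ (e.symm y))) x u) (fderiv ℝ (fun y => e' (φ (e.symm y))) x v)
  rw [metricInChart_apply, metricInChart_apply, key, key, e'.left_inv hx.2]
  exact h1.symm

end Immersion

end SpaceFormSurface

end

theorem mainTheorem2
    {M : Type*} [TopologicalSpace M] [ChartedSpace (SpaceFormSurface.Coord 2) M]
    [IsManifold (𝓡 2) ∞ M]
    {N : Type*} [TopologicalSpace N] [ChartedSpace (SpaceFormSurface.Coord 4) N]
    [IsManifold (𝓡 4) ∞ N]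
    (g : SpaceFormSurface.Metric 2 M) (h : SpaceFormSurface.Metric 4 N)
    (c : ℝ) (hc : c ≠ 0) (hN : SpaceFormSurface.HasConstantSectionalCurvature h c)
    (φ : M → N) (hφ : SpaceFormSurface.IsIsometricImmersion g h φ)
    (hbi : SpaceFormSurface.IsBiconservative g h φ)
    (hcmc : SpaceFormSurface.IsCMC g h φ) :
    SpaceFormSurface.IsPMC g h φ := by
  intro e he e' he' p hp hφp u
  obtain ⟨κ, hκ⟩ := hcmc
  refine (SpaceFormSurface.isIsometricOn_inCharts hφ he he').normalCovMeanCurv_eq_zero hc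
    (κ := κ) ?_ ?_ ?_ ⟨e.map_source hp, ?_⟩ u
  -- The manifold hypotheses concern points `e p` or `e' q`; a coordinate point is brought to this
  -- form by the inverse chart.
  · intro z hz u v huv
    have h1 := hN e' he' (e'.symm z) (e'.map_target hz) u v huv
    rwa [e'.right_inv hz] at h1
  · intro x hx v
    have h1 := hbi e he e' he' (e.symm x) (e.map_target hx.1) hx.2 v
    rwa [e.right_inv hx.1] at h1
  · intro x hx
    have h1 := hκ e he e' he' (e.symm x) (e.map_target hx.1) hx.2
    rwa [e.right_inv hx.1] at h1
  · change φ (e.symm (e p)) ∈ e'.source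
    rwa [e.left_inv hp]
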